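/- Let $2\le k\le n-2$ and let $\Delta_{k,n}=\{x\in[0,1]^n:\ x_1+\cdots+x_n=k\}$. For $I\subseteq\{1,\dots,n\}$ put $e_I=\sum_{i\in I}e_i$. With indices modulo $n$, for $j=1,\dots,n$ let $$[j,j+1,\dots,j-1]=\Big\{x\in\mathbb R^n:\ \sum_{i=1}^n x_i=0,\ \ x_j+x_{j+1}+\cdots+x_{j+m-1}\ge 0\ \text{ for } 1\le m\le n-1\Big\},$$ and let the blade $((1,2,\dots,n))$ be the union over $j=1,\dots,n$ of the relative boundaries (that is, the unions of the codimension one faces) of these cones; $((1,2,\dots,n))_{p}$ denotes its translate by $p\in\mathbb R^n$. A set of translated blades induces a matroid subdivision of $\Delta_{k,n}$ if the chambers, i.e. the closures of the connected components of the complement in $\Delta_{k,n}$ of the union of these blades, are the maximal cells of a polytopal subdivision of $\Delta_{k,n}$ and every chamber is a matroid polytope, i.e. the convex hull of the vectors $e_B$ for $B$ running over the bases of some matroid on $\{1,\dots,n\}$. Two $k$-element subsets $I,J$ of $\{1,\dots,n\}$ are weakly separated if there are no $i_1,i_2\in I\setminus J$ and $j_1,j_2\in J\setminus I$ such that $i_1<j_1<i_2<j_2$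 or one of its cyclic rotations holds. **Lemma.** For any two $k$-element subsets $I_1,I_2$ of $\{1,\dots,n\}$, the blade arrangement $$\{((1,2,\dots,n))_{e_{I_1}},\ ((1,2,\dots,n))_{e_{I_2}}\}$$ induces a matroid subdivision of $\Delta_{k,n}$ if and only if $\{I_1,I_2\}$ is weakly separated. -/

import Mathlib

namespace BladeArrangement

/-- The indicator vector `e_I = ∑_{i ∈ I} e_i` in `ℝⁿ`; for `|I| = k` these are the vertices
of the hypersimplex. -/
def vertex {n : ℕ} (I : Finset (Fin n)) : Fin n → ℝ := fun i => if i ∈ I then 1 else 0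

/-- The hypersimplex `Δ_{k,n} = {x ∈ [0,1]ⁿ : x₁ + ⋯ + xₙ = k}`. -/
def hypersimplex (k n : ℕ) : Set (Fin n → ℝ) :=
  {x | (∀ i, 0 ≤ x i ∧ x i ≤ 1) ∧ ∑ i, x i = (k : ℝ)}

/-- The index obtained from `j` by moving `t` steps forward in the cyclic order `(1, 2, …, n)`. -/
def cyclicShift {n : ℕ} (j : Fin n) (t : ℕ) : Fin n := ⟨(j.val + t) % n, Nat.mod_lt _ j.pos⟩

/-- The cyclic partial sum `x_j + x_{j+1} + ⋯ + x_{j+m-1}` of `m` terms, indices modulo `n`. -/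
def cyclicSum {n : ℕ} (x : Fin n → ℝ) (j : Fin n) (m : ℕ) : ℝ :=
  ∑ t ∈ Finset.range m, x (cyclicShift j t)

/-- The simplicial cone (plate) `[j, j+1, …, j-1]` in the hyperplane `x₁ + ⋯ + xₙ = 0`, cut out
by the facet inequalities `x_j ≥ 0, x_j + x_{j+1} ≥ 0, …, x_j + ⋯ + x_{j-2} ≥ 0`. -/
def plate {n : ℕ} (j : Fin n) : Set (Fin n → ℝ) :=
  {x | ∑ i, x i = 0 ∧ ∀ m : ℕ, 1 ≤ m → m < n → 0 ≤ cyclicSum x j m}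

/-- The relative boundary of the cone `[j, j+1, …, j-1]`: the union of its codimension one faces,
i.e. the points of the cone where at least one of the facet inequalities is an equality. -/
def plateBoundary {n : ℕ} (j : Fin n) : Set (Fin n → ℝ) :=
  {x | x ∈ plate j ∧ ∃ m : ℕ, 1 ≤ m ∧ m < n ∧ cyclicSum x j m = 0}

/-- The blade `((1, 2, …, n))`: the union of the boundaries of the `n` cyclic rotations of the
cone `[1, 2, …, n]`. -/
def blade (n : ℕ) : Set (Fin n → ℝ) := ⋃ j : Fin n, plateBoundary j

/-- The translate `((1, 2, …, n))_p` of the blade by a vector `p`. -/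
def bladeAt {n : ℕ} (p : Fin n → ℝ) : Set (Fin n → ℝ) := {x | x - p ∈ blade n}

/-- The part of the hypersimplex that lies on none of the blades `((1, 2, …, n))_{e_I}`,
`I ∈ A`. -/
def bladeComplement (k : ℕ) {n : ℕ} (A : Set (Finset (Fin n))) : Set (Fin n → ℝ) :=
  hypersimplex k n \ ⋃ I ∈ A, bladeAt (vertex I)

/-- The chambers (maximal cells) into which the blades placed on the vertices `e_I`, `I ∈ A`, cut
the hypersimplex: the closures of the connected components of the complement of the blades. -/
def chambers (k : ℕ) {n : ℕ} (A : Set (Finset (Fin n))) : Set (Set (Fin n → ℝ)) :=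
  {C | ∃ x ∈ bladeComplement k A, C = closure (connectedComponentIn (bladeComplement k A) x)}

/-- A (convex) polytope: the convex hull of a finite set of points. -/
def IsPolytope {n : ℕ} (C : Set (Fin n → ℝ)) : Prop :=
  ∃ V : Set (Fin n → ℝ), V.Finite ∧ C = convexHull ℝ V

/-- `𝒞` is the set of maximal cells of a polytopal subdivision of `P`: finitely many polytopes of
the same dimension as `P`, with union `P`, any two of which meet in a (possibly empty) common
face. For polytopes, faces are the same as exposed faces. -/
structure IsPolytopalSubdivision {n : ℕ} (P : Set (Fin n → ℝ)) (𝒞 : Set (Set (Fin n → ℝ))) :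
    Prop where
  finite : 𝒞.Finite
  isPolytope : ∀ C ∈ 𝒞, IsPolytope C
  fullDim : ∀ C ∈ 𝒞, affineSpan ℝ C = affineSpan ℝ P
  cover : ⋃₀ 𝒞 = P
  face : ∀ C ∈ 𝒞, ∀ D ∈ 𝒞, IsExposed ℝ C (C ∩ D) ∧ IsExposed ℝ D (C ∩ D)

/-- A matroid polytope: the convex hull of the vectors `e_B`, `B` running over the bases of a
matroid on `{1, …, n}`. -/
def IsMatroidPolytope {n : ℕ} (C : Set (Fin n → ℝ)) : Prop :=
  ∃ M : Matroid (Fin n), M.E = Set.univ ∧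
    C = convexHull ℝ {v | ∃ B : Finset (Fin n), M.IsBase (B : Set (Fin n)) ∧ v = vertex B}

/-- The blades `((1, 2, …, n))_{e_I}`, `I ∈ A`, induce a matroid subdivision of `Δ_{k,n}`: the
chambers are the maximal cells of a polytopal subdivision, and each one is a matroid polytope. -/
def InducesMatroidSubdivision (k : ℕ) {n : ℕ} (A : Set (Finset (Fin n))) : Prop :=
  IsPolytopalSubdivision (hypersimplex k n) (chambers k A) ∧
    ∀ C ∈ chambers k A, IsMatroidPolytope C

/-- `I` and `J` are weakly separated: there are no `i₁, i₂ ∈ I \ J` and `j₁, j₂ ∈ J \ I` such that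
`i₁ < j₁ < i₂ < j₂` or one of its cyclic rotations holds. -/
def WeaklySeparated {n : ℕ} (I J : Finset (Fin n)) : Prop :=
  ¬ ∃ i₁ ∈ I \ J, ∃ i₂ ∈ I \ J, ∃ j₁ ∈ J \ I, ∃ j₂ ∈ J \ I,
    (i₁ < j₁ ∧ j₁ < i₂ ∧ i₂ < j₂) ∨ (j₁ < i₂ ∧ i₂ < j₂ ∧ j₂ < i₁) ∨
    (i₂ < j₂ ∧ j₂ < i₁ ∧ i₁ < j₁) ∨ (j₂ < i₁ ∧ i₁ < j₁ ∧ j₁ < i₂)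

end BladeArrangement

/-! Let the height of `x` at `t` be the sum of its entries before `t`. The plate at `e_I` with apex
`i` consists of the points whose height minus that of `e_I` is minimal at `i`, and the blade is the
locus where this minimum is attained twice. Chambers of two blades are thus labelled by pairs of
apices `(i, j)`: each is a `cell`, cut out of the hypersimplex by inequalities between heights with
integer constants. In all cases these chambers cover the hypersimplex and meet along faces. By
`cell_eq_convexHull` each is the hull of its 0/1 points: adding a common random shift to all heights
and rounding down preserves such inequalities, and the mean of the result is the original point.
Only the basis exchange property is at stake.

Without a crossing, exchange holds (`exists_exchange`). Replacing `e` by `f` is harmless when `f`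
lies in every tight cyclic interval that contains `e`; such intervals starting at `i` have a
smallest member `S`, those starting at `j` a smallest member `T`. A suitable `f` exists once `B` has
at most as many elements in `S ∩ T` as `B'`. This is formal unless the two arcs properly overlap;
there a failure makes `gap`, the difference of the heights of `e_I` and `e_J`, alternate around a
level, hence gives a crossing (`crossing_of_alternating`).

Conversely, a crossing gives a level `t` around which `gap` alternates. The pointwise maxima of the
height of `I` and the height of `J` raised by `t`, respectively `t + 1`, define two vertices of any
chamber containing their midpoint. Exchange between them would make the set where `gap` exceeds `t`
a single cyclic interval (`not_alternating_of_exchange`), which alternation forbids. -/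

namespace BladeArrangement

/-! ### Heights; plates and blades as minimum loci -/

/-- The sum of the entries of `x` in the positions before `t`. -/
def height {n : ℕ} {R : Type*} [AddCommMonoid R] (x : Fin n → R) (t : ℕ) : R :=
  ∑ s ∈ Finset.univ.filter (fun s : Fin n => s.val < t), x s

section Height

variable {n : ℕ} {R : Type*} [AddCommMonoid R]

@[simp]
theorem height_zero (x : Fin n → R) : height x 0 = 0 := by simp [height]

theorem height_self (x : Fin n → R) : height x n = ∑ i, x i := by simp [height]

theorem height_succ (x : Fin n → R) (s : Fin n) : height x (s + 1) = height x s + x s := by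
  have h : Finset.univ.filter (fun r : Fin n => r.val < s.val + 1) =
      insert s (Finset.univ.filter (fun r : Fin n => r.val < s.val)) := by
    ext r
    simp only [Finset.mem_filter, Finset.mem_univ, true_and, Finset.mem_insert, Fin.ext_iff]
    omega
  rw [height, h, Finset.sum_insert (by simp), add_comm, height]

theorem height_add (x y : Fin n → R) (t : ℕ) : height (x + y) t = height x t + height y t := by
  simp [height, Finset.sum_add_distrib]

end Height

theorem height_sub {n : ℕ} (x y : Fin n → ℝ) (t : ℕ) :
    height (x - y) t = height x t - height y t := by
  simp [height, Finset.sum_sub_distrib]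

theorem height_smul {n : ℕ} (c : ℝ) (x : Fin n → ℝ) (t : ℕ) :
    height (c • x) t = c * height x t := by
  simp [height, Finset.mul_sum]

theorem continuous_height {n : ℕ} (t : ℕ) : Continuous (fun x : Fin n → ℝ => height x t) := by
  unfold height; fun_prop

/-- A vanishing total makes the heights at `n` and at `0` agree, so height is a function on the
cycle and wrapping around costs nothing. -/
theorem cyclicSum_eq {n : ℕ} {x : Fin n → ℝ} (hx : ∑ i, x i = 0) (j : Fin n) (m : ℕ) :
    cyclicSum x j m = height x (cyclicShift j m) - height x j := by
  have hn := j.pos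
  induction m with
  | zero => simp [cyclicSum, cyclicShift, Nat.mod_eq_of_lt j.isLt]
  | succ m ih =>
    have h1 : cyclicSum x j (m + 1) = cyclicSum x j m + x (cyclicShift j m) := by
      simp [cyclicSum, Finset.sum_range_succ]
    have h2 : height x (cyclicShift j (m + 1)) = height x ((cyclicShift j m : ℕ) + 1) := by
      by_cases h : (j + m) % n + 1 = n
      · have e1 : (cyclicShift j (m + 1) : ℕ) = 0 := by
          simp only [cyclicShift, ← add_assoc]
          rw [← Nat.mod_add_mod, h, Nat.mod_self]
        have e2 : (cyclicShift j m : ℕ) + 1 = n := by simpa [cyclicShift] using h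
        rw [e1, e2, height_self, hx, height_zero]
      · have h3 := Nat.mod_lt (j + m) hn
        congr 1
        simp only [cyclicShift, ← add_assoc]
        rw [← Nat.mod_add_mod, Nat.mod_eq_of_lt (by omega)]
    rw [h1, ih, h2, height_succ]
    ring

theorem exists_cyclicShift_eq {n : ℕ} {j l : Fin n} (h : l ≠ j) :
    ∃ m, 1 ≤ m ∧ m < n ∧ cyclicShift j m = l := by
  have hl := l.isLt
  have hj := j.isLt
  have h' : l.val ≠ j.val := fun e => h (Fin.ext e)
  rcases lt_or_gt_of_ne h' with h1 | h1
  · refine ⟨l + n - j, by omega, by omega, Fin.ext ?_⟩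
    simp only [cyclicShift]
    rw [show j.val + (l + n - j) = l + n by omega, Nat.add_mod_right, Nat.mod_eq_of_lt hl]
  · refine ⟨l - j, by omega, by omega, Fin.ext ?_⟩
    simp only [cyclicShift]
    rw [show j.val + (l - j) = l by omega, Nat.mod_eq_of_lt hl]

theorem cyclicShift_ne {n : ℕ} (j : Fin n) {m : ℕ} (h1 : 1 ≤ m) (h2 : m < n) :
    cyclicShift j m ≠ j := by
  intro h
  have h3 : (j.val + m) % n = j.val := congrArg Fin.val h
  have hj := j.isLt
  rcases Nat.lt_or_ge (j.val + m) n with h4 | h4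
  · rw [Nat.mod_eq_of_lt h4] at h3; omega
  · rw [Nat.mod_eq_sub_mod h4, Nat.mod_eq_of_lt (by omega)] at h3; omega

theorem mem_plate {n : ℕ} {x : Fin n → ℝ} {j : Fin n} :
    x ∈ plate j ↔ ∑ i, x i = 0 ∧ ∀ l : Fin n, height x j ≤ height x l := by
  constructor
  · rintro ⟨hx, h⟩
    refine ⟨hx, fun l => ?_⟩
    by_cases hl : l = j
    · rw [hl]
    · obtain ⟨m, h1, h2, rfl⟩ := exists_cyclicShift_eq hl
      have := h m h1 h2
      rw [cyclicSum_eq hx] at this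
      linarith
  · rintro ⟨hx, h⟩
    refine ⟨hx, fun m _ _ => ?_⟩
    rw [cyclicSum_eq hx]
    linarith [h (cyclicShift j m)]

theorem mem_blade {n : ℕ} {x : Fin n → ℝ} (hx : ∑ i, x i = 0) :
    x ∈ blade n ↔ ∃ j l : Fin n, l ≠ j ∧ height x l = height x j ∧
      ∀ r : Fin n, height x j ≤ height x r := by
  simp only [blade, Set.mem_iUnion, plateBoundary, Set.mem_ofPred_eq, mem_plate]
  constructor
  · rintro ⟨j, ⟨_, h⟩, m, h1, h2, h3⟩
    rw [cyclicSum_eq hx] at h3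
    exact ⟨j, _, cyclicShift_ne j h1 h2, by linarith, h⟩
  · rintro ⟨j, l, hl, h1, h2⟩
    obtain ⟨m, h3, h4, rfl⟩ := exists_cyclicShift_eq hl
    exact ⟨j, ⟨hx, h2⟩, m, h3, h4, by rw [cyclicSum_eq hx]; linarith⟩

theorem not_mem_blade {n : ℕ} (hn : 0 < n) {x : Fin n → ℝ} (hx : ∑ i, x i = 0) :
    x ∉ blade n ↔ ∃ j : Fin n, ∀ l, l ≠ j → height x j < height x l := by
  rw [mem_blade hx]
  constructor
  · intro h
    have : Nonempty (Fin n) := ⟨⟨0, hn⟩⟩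
    obtain ⟨j, hj⟩ := Finite.exists_min (fun l : Fin n => height x l)
    refine ⟨j, fun l hl => lt_of_le_of_ne (hj l) fun e => h ⟨j, l, hl, e.symm, hj⟩⟩
  · rintro ⟨i, hi⟩ ⟨j, l, hl, h1, h2⟩
    by_cases h : j = i
    · subst h
      exact absurd h1 (hi l hl).ne'
    · exact absurd (hi j h) (not_lt.2 (h2 i))

/-! ### Integer heights of subsets -/

/-- The number of elements of `B` before position `t`. -/
def count {n : ℕ} (B : Finset (Fin n)) (t : ℕ) : ℤ := height (fun s => if s ∈ B then (1 : ℤ) else 0) t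

@[simp]
theorem count_zero {n : ℕ} (B : Finset (Fin n)) : count B 0 = 0 := height_zero _

theorem count_self {n : ℕ} (B : Finset (Fin n)) : count B n = B.card := by
  simp [count, height_self]

theorem count_succ {n : ℕ} (B : Finset (Fin n)) (s : Fin n) :
    count B (s + 1) = count B s + if s ∈ B then 1 else 0 := height_succ _ _

theorem height_vertex {n : ℕ} (B : Finset (Fin n)) (t : ℕ) : height (vertex B) t = count B t := by
  simp [count, height, vertex]

theorem sum_vertex {n : ℕ} (B : Finset (Fin n)) : ∑ i, vertex B i = B.card := by
  simp [vertex]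

/-- The set of steps at which the height function `F` increases by one. -/
def ofHeight (n : ℕ) (F : ℕ → ℤ) : Finset (Fin n) :=
  Finset.univ.filter fun s => F (s + 1) = F s + 1

theorem count_ofHeight {n : ℕ} {F : ℕ → ℤ} (hF : ∀ s < n, F (s + 1) = F s ∨ F (s + 1) = F s + 1)
    {t : ℕ} (ht : t ≤ n) : count (ofHeight n F) t = F t - F 0 := by
  induction t with
  | zero => simp
  | succ t ih =>
    have h1 := count_succ (ofHeight n F) ⟨t, ht⟩
    simp only [ofHeight, Finset.mem_filter, Finset.mem_univ, true_and] at h1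
    rw [ofHeight, h1]
    have h2 := ih (by omega)
    rw [ofHeight] at h2
    rw [h2]
    rcases hF t ht with h | h <;> simp [h]
    ring

theorem count_exchange {n : ℕ} {B : Finset (Fin n)} {e f : Fin n} (he : e ∈ B) (hf : f ∉ B)
    (t : ℕ) : count (insert f (B.erase e)) t =
      count B t - (if e.val < t then 1 else 0) + (if f.val < t then 1 else 0) := by
  have key : ∀ s : Fin n, (if s ∈ insert f (B.erase e) then (1 : ℤ) else 0) =
      (if s ∈ B then 1 else 0) - (if s = e then 1 else 0) + (if s = f then 1 else 0) := by
    intro s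
    by_cases h1 : s = f
    · subst h1
      have : s ≠ e := fun h => hf (h ▸ he)
      simp [this, hf]
    · by_cases h2 : s = e
      · subst h2; simp [h1, he]
      · simp [h1, h2]
  simp only [count, height, key, Finset.sum_add_distrib, Finset.sum_sub_distrib,
    Finset.sum_ite_eq', Finset.mem_filter, Finset.mem_univ, true_and]

theorem card_exchange {n : ℕ} {B : Finset (Fin n)} {e f : Fin n} (he : e ∈ B) (hf : f ∉ B) :
    (insert f (B.erase e)).card = B.card := by
  rw [Finset.card_insert_of_notMem (by simp [hf]), Finset.card_erase_add_one he]

/-! ### Chambers as cells indexed by two apices -/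

/-- The height of `x` relative to the vertex `e_I`. -/
def dev {n : ℕ} (I : Finset (Fin n)) (x : Fin n → ℝ) (l : Fin n) : ℝ := height x l - count I l

/-- The points of the hypersimplex lying in the interiors of the `i`-th plate at `e_I` and the
`j`-th plate at `e_J`. -/
def region (k : ℕ) {n : ℕ} (I J : Finset (Fin n)) (i j : Fin n) : Set (Fin n → ℝ) :=
  {x | x ∈ hypersimplex k n ∧ (∀ l, l ≠ i → dev I x i < dev I x l) ∧
    ∀ l, l ≠ j → dev J x j < dev J x l}

/-- The points of the hypersimplex lying in the `i`-th plate at `e_I` and the `j`-th plate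
at `e_J`. -/
def cell (k : ℕ) {n : ℕ} (I J : Finset (Fin n)) (i j : Fin n) : Set (Fin n → ℝ) :=
  {x | x ∈ hypersimplex k n ∧ (∀ l, dev I x i ≤ dev I x l) ∧ ∀ l, dev J x j ≤ dev J x l}

section Regions

variable {k n : ℕ} {I J : Finset (Fin n)} {i j : Fin n}

theorem continuous_dev (I : Finset (Fin n)) (l : Fin n) : Continuous fun x => dev I x l :=
  (continuous_height _).sub continuous_const

theorem dev_combo (I : Finset (Fin n)) (x y : Fin n → ℝ) (l : Fin n) {a b : ℝ} (h : a + b = 1) :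
    dev I (a • x + b • y) l = a * dev I x l + b * dev I y l := by
  have : b = 1 - a := by linarith
  subst this
  simp only [dev, height_add, height_smul]
  ring

theorem mem_hypersimplex {x : Fin n → ℝ} :
    x ∈ hypersimplex k n ↔ (∀ i, 0 ≤ x i ∧ x i ≤ 1) ∧ ∑ i, x i = (k : ℝ) := Iff.rfl

theorem convex_hypersimplex : Convex ℝ (hypersimplex k n) := by
  rintro x ⟨hx, hx'⟩ y ⟨hy, hy'⟩ a b ha hb hab
  refine ⟨fun i => ?_, ?_⟩
  · have h1 := hx i
    have h2 := hy i
    simp only [Pi.add_apply, Pi.smul_apply, smul_eq_mul]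
    constructor
    · nlinarith [mul_nonneg ha h1.1, mul_nonneg hb h2.1]
    · nlinarith [mul_le_mul_of_nonneg_left h1.2 ha, mul_le_mul_of_nonneg_left h2.2 hb]
  · simp only [Pi.add_apply, Pi.smul_apply, smul_eq_mul, Finset.sum_add_distrib,
      ← Finset.mul_sum, hx', hy']
    rw [← add_mul, hab, one_mul]

theorem isClosed_hypersimplex : IsClosed (hypersimplex k n) := by
  have h : hypersimplex k n = (⋂ i, {x | 0 ≤ x i} ∩ {x | x i ≤ 1}) ∩ {x | ∑ i, x i = (k : ℝ)} := by
    ext x; simp [mem_hypersimplex]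
  rw [h]
  refine IsClosed.inter (isClosed_iInter fun i => ?_) (isClosed_eq (by fun_prop) (by fun_prop))
  exact (isClosed_le (by fun_prop) (by fun_prop)).inter (isClosed_le (by fun_prop) (by fun_prop))

theorem isClosed_cell : IsClosed (cell k I J i j) := by
  have h : cell k I J i j = hypersimplex k n ∩ ((⋂ l, {x | dev I x i ≤ dev I x l}) ∩
      ⋂ l, {x | dev J x j ≤ dev J x l}) := by
    ext x; simp only [cell, Set.mem_inter_iff, Set.mem_iInter, Set.mem_ofPred_eq]
  rw [h]
  exact isClosed_hypersimplex.inter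
    ((isClosed_iInter fun l => isClosed_le (continuous_dev _ _) (continuous_dev _ _)).inter
    (isClosed_iInter fun l => isClosed_le (continuous_dev _ _) (continuous_dev _ _)))

theorem region_subset_cell : region k I J i j ⊆ cell k I J i j := by
  rintro x ⟨h, h1, h2⟩
  refine ⟨h, fun l => ?_, fun l => ?_⟩
  · by_cases hl : l = i
    · rw [hl]
    · exact (h1 l hl).le
  · by_cases hl : l = j
    · rw [hl]
    · exact (h2 l hl).le

theorem combo_mem_region {x y : Fin n → ℝ} (hx : x ∈ cell k I J i j) (hy : y ∈ region k I J i j)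
    {a b : ℝ} (ha : 0 ≤ a) (hb : 0 < b) (hab : a + b = 1) : a • x + b • y ∈ region k I J i j := by
  refine ⟨convex_hypersimplex hx.1 hy.1 ha hb.le hab, fun l hl => ?_, fun l hl => ?_⟩
  · rw [dev_combo _ _ _ _ hab, dev_combo _ _ _ _ hab]
    nlinarith [mul_le_mul_of_nonneg_left (hx.2.1 l) ha, mul_lt_mul_of_pos_left (hy.2.1 l hl) hb]
  · rw [dev_combo _ _ _ _ hab, dev_combo _ _ _ _ hab]
    nlinarith [mul_le_mul_of_nonneg_left (hx.2.2 l) ha, mul_lt_mul_of_pos_left (hy.2.2 l hl) hb]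

theorem convex_region : Convex ℝ (region k I J i j) := by
  intro x hx y hy a b ha hb hab
  rcases hb.eq_or_lt with h | h
  · have : a = 1 := by linarith
    subst this; subst h
    simpa using hx
  · exact combo_mem_region (region_subset_cell hx) hy ha h hab

/-- An open segment from a point of the cell to a point of the region stays in the region, because a
strict inequality survives averaging with a weak one. -/
theorem closure_region (h : (region k I J i j).Nonempty) :
    closure (region k I J i j) = cell k I J i j := by
  obtain ⟨y, hy⟩ := h
  refine Set.Subset.antisymm (closure_minimal region_subset_cell isClosed_cell) fun x hx => ?_
  have h1 : openSegment ℝ x y ⊆ region k I J i j := by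
    rintro _ ⟨a, b, ha, hb, hab, rfl⟩
    exact combo_mem_region hx hy ha.le hb hab
  have h2 := closure_mono h1
  rw [closure_openSegment] at h2
  exact h2 (left_mem_segment ℝ x y)

/-- The open subset of the ambient space that cuts out `region k I J i j`. -/
def openRegion {n : ℕ} (I J : Finset (Fin n)) (i j : Fin n) : Set (Fin n → ℝ) :=
  {x | (∀ l, l ≠ i → dev I x i < dev I x l) ∧ ∀ l, l ≠ j → dev J x j < dev J x l}

theorem isOpen_openRegion : IsOpen (openRegion I J i j) := by
  have h : openRegion I J i j = (⋂ l : {l // l ≠ i}, {x | dev I x i < dev I x l}) ∩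
      ⋂ l : {l // l ≠ j}, {x | dev J x j < dev J x l} := by
    ext x; simp [openRegion]
  rw [h]
  exact (isOpen_iInter_of_finite fun l => isOpen_lt (continuous_dev _ _) (continuous_dev _ _)).inter
    (isOpen_iInter_of_finite fun l => isOpen_lt (continuous_dev _ _) (continuous_dev _ _))

theorem openRegion_inj {x : Fin n → ℝ} {i' j' : Fin n} (h : x ∈ openRegion I J i j)
    (h' : x ∈ openRegion I J i' j') : i = i' ∧ j = j' := by
  constructor
  · by_contra hne
    exact lt_asymm (h.1 i' (Ne.symm hne)) (h'.1 i hne)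
  · by_contra hne
    exact lt_asymm (h.2 j' (Ne.symm hne)) (h'.2 j hne)

theorem not_mem_bladeAt (hn : 0 < n) (hI : I.card = k) {x : Fin n → ℝ} (hx : x ∈ hypersimplex k n) :
    x ∉ bladeAt (vertex I) ↔ ∃ i : Fin n, ∀ l, l ≠ i → dev I x i < dev I x l := by
  have h0 : ∑ i, (x - vertex I) i = 0 := by
    simp only [Pi.sub_apply, Finset.sum_sub_distrib, sum_vertex, hx.2, hI, sub_self]
  change x - vertex I ∉ blade n ↔ _
  rw [not_mem_blade hn h0]
  simp only [height_sub, height_vertex, dev]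

theorem mem_bladeComplement (hn : 0 < n) (hI : I.card = k) (hJ : J.card = k) {x : Fin n → ℝ} :
    x ∈ bladeComplement k {I, J} ↔ ∃ i j, x ∈ region k I J i j := by
  have h : x ∈ bladeComplement k {I, J} ↔
      x ∈ hypersimplex k n ∧ x ∉ bladeAt (vertex I) ∧ x ∉ bladeAt (vertex J) := by
    simp [bladeComplement]
  rw [h]
  constructor
  · rintro ⟨hx, h1, h2⟩
    obtain ⟨i, hi⟩ := (not_mem_bladeAt hn hI hx).1 h1
    obtain ⟨j, hj⟩ := (not_mem_bladeAt hn hJ hx).1 h2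
    exact ⟨i, j, hx, hi, hj⟩
  · rintro ⟨i, j, hx, hi, hj⟩
    exact ⟨hx, (not_mem_bladeAt hn hI hx).2 ⟨i, hi⟩, (not_mem_bladeAt hn hJ hx).2 ⟨j, hj⟩⟩

/-- The region is convex, hence connected. The sets `openRegion` are open, pairwise disjoint and
cover the complement of the blades, so a component cannot leave the one it meets. -/
theorem connectedComponentIn_eq_region (hI : I.card = k) (hJ : J.card = k) {x : Fin n → ℝ}
    (hx : x ∈ region k I J i j) :
    connectedComponentIn (bladeComplement k {I, J}) x = region k I J i j := by
  have hn : 0 < n := i.pos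
  have hsub : region k I J i j ⊆ bladeComplement k {I, J} := fun y hy =>
    (mem_bladeComplement hn hI hJ).2 ⟨i, j, hy⟩
  refine Set.Subset.antisymm ?_
    (convex_region.isPreconnected.subset_connectedComponentIn hx hsub)
  have hcc := connectedComponentIn_subset (bladeComplement k {I, J}) x
  have hpre := isPreconnected_connectedComponentIn (F := bladeComplement k {I, J}) (x := x)
  have hxc := mem_connectedComponentIn (hsub hx)
  have h1 := hpre.subset_left_of_subset_union (u := openRegion I J i j)
    (v := ⋃ p : {p : Fin n × Fin n // p ≠ (i, j)}, openRegion I J p.1.1 p.1.2)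
    isOpen_openRegion (isOpen_iUnion fun _ => isOpen_openRegion) ?_ ?_ ⟨x, hxc, hx.2⟩
  · intro y hy
    obtain ⟨i', j', hy'⟩ := (mem_bladeComplement hn hI hJ).1 (hcc hy)
    exact ⟨hy'.1, h1 hy⟩
  · rw [Set.disjoint_iUnion_right]
    rintro ⟨⟨i', j'⟩, hp⟩
    rw [Set.disjoint_left]
    intro y hy hy'
    obtain ⟨rfl, rfl⟩ := openRegion_inj hy hy'
    exact hp rfl
  · intro y hy
    obtain ⟨i', j', hy'⟩ := (mem_bladeComplement hn hI hJ).1 (hcc hy)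
    by_cases hp : (i', j') = (i, j)
    · obtain ⟨rfl, rfl⟩ := Prod.ext_iff.1 hp
      exact Or.inl hy'.2
    · exact Or.inr (Set.mem_iUnion.2 ⟨⟨(i', j'), hp⟩, hy'.2⟩)

theorem mem_chambers (hn : 0 < n) (hI : I.card = k) (hJ : J.card = k) {C : Set (Fin n → ℝ)} :
    C ∈ chambers k {I, J} ↔ ∃ i j, (region k I J i j).Nonempty ∧ C = cell k I J i j := by
  constructor
  · rintro ⟨x, hx, rfl⟩
    obtain ⟨i, j, hij⟩ := (mem_bladeComplement hn hI hJ).1 hx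
    exact ⟨i, j, ⟨x, hij⟩, by
      rw [connectedComponentIn_eq_region hI hJ hij, closure_region ⟨x, hij⟩]⟩
  · rintro ⟨i, j, ⟨x, hij⟩, rfl⟩
    exact ⟨x, (mem_bladeComplement hn hI hJ).2 ⟨i, j, hij⟩, by
      rw [connectedComponentIn_eq_region hI hJ hij, closure_region ⟨x, hij⟩]⟩

/-- Moving slightly from a point of the region toward any point of the hypersimplex stays in the
region, so that point lies on a line through two points of the cell. -/
theorem affineSpan_cell (h : (region k I J i j).Nonempty) :
    affineSpan ℝ (cell k I J i j) = affineSpan ℝ (hypersimplex k n) := by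
  refine le_antisymm (affineSpan_mono ℝ fun x hx => hx.1) (affineSpan_le.2 fun y hy => ?_)
  obtain ⟨x, hx⟩ := h
  have hc : Continuous fun t : ℝ => AffineMap.lineMap x y t := AffineMap.lineMap_continuous
  have h0 : (fun t : ℝ => AffineMap.lineMap x y t) 0 ∈ openRegion I J i j := by
    simp only [AffineMap.lineMap_apply_zero]
    exact hx.2
  have h1 := (hc.continuousAt (x := 0)).eventually (isOpen_openRegion.mem_nhds h0)
  obtain ⟨ε, hε, h2⟩ := Metric.eventually_nhds_iff.1 h1
  set t := min (ε / 2) 1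
  have ht : 0 < t := lt_min (by linarith) one_pos
  have ht1 : t ≤ 1 := min_le_right _ _
  have h3 : AffineMap.lineMap x y t ∈ openRegion I J i j := by
    apply h2
    rw [Real.dist_eq, sub_zero, abs_of_pos ht]
    exact lt_of_le_of_lt (min_le_left _ _) (by linarith)
  have h4 : AffineMap.lineMap x y t ∈ hypersimplex k n := by
    rw [AffineMap.lineMap_apply_module]
    exact convex_hypersimplex hx.1 hy (by linarith) ht.le (by ring)
  have h5 : y = AffineMap.lineMap x (AffineMap.lineMap x y t : Fin n → ℝ) t⁻¹ := by
    rw [AffineMap.lineMap_lineMap_right, inv_mul_cancel₀ ht.ne', AffineMap.lineMap_apply_one]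
  rw [SetLike.mem_coe, h5]
  exact AffineMap.lineMap_mem _ (subset_affineSpan ℝ _ (region_subset_cell hx))
    (subset_affineSpan ℝ _ (region_subset_cell ⟨h4, h3⟩))

/-- The height at `l` as a continuous linear functional. -/
noncomputable def heightCLM (n : ℕ) (t : ℕ) : (Fin n → ℝ) →L[ℝ] ℝ :=
  ∑ s ∈ Finset.univ.filter (fun s : Fin n => s.val < t), ContinuousLinearMap.proj s

theorem heightCLM_apply (t : ℕ) (x : Fin n → ℝ) : heightCLM n t x = height x t := by
  simp [heightCLM, height]

theorem isExposed_cell_inter {i' j' : Fin n} :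
    IsExposed ℝ (cell k I J i j) (cell k I J i j ∩ cell k I J i' j') := by
  rintro ⟨z, hz, hz'⟩
  -- On the first cell both differences are bounded above, and the common point `z` attains both
  -- bounds. So the sum is maximal exactly where both bounds are attained, that is, where `i'` and
  -- `j'` are apices too.
  refine ⟨heightCLM n i - heightCLM n i' + (heightCLM n j - heightCLM n j'), ?_⟩
  have hz1 := hz.2.1 i'
  have hz2 := hz.2.2 j'
  have hz1' := hz'.2.1 i
  have hz2' := hz'.2.2 j
  ext x
  simp only [Set.mem_inter_iff, Set.mem_ofPred_eq, add_apply, sub_apply, heightCLM_apply]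
  simp only [dev] at hz1 hz2 hz1' hz2'
  constructor
  · rintro ⟨hx, hx'⟩
    refine ⟨hx, fun y hy => ?_⟩
    have h1 := hy.2.1 i'
    have h2 := hy.2.2 j'
    have h1' := hx'.2.1 i
    have h2' := hx'.2.2 j
    simp only [dev] at h1 h2 h1' h2'
    linarith
  · rintro ⟨hx, h⟩
    refine ⟨hx, hx.1, fun l => ?_, fun l => ?_⟩
    · refine le_trans ?_ (hx.2.1 l)
      have h1 := hx.2.2 j'
      have h2 := h z hz
      simp only [dev] at h1 ⊢
      linarith
    · refine le_trans ?_ (hx.2.2 l)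
      have h1 := hx.2.1 i'
      have h2 := h z hz
      simp only [dev] at h1 ⊢
      linarith

end Regions

/-! ### Generic points and the covering by chambers -/

open Filter Topology in
/-- Two affine functions of a parameter that differ at the parameter `1` differ at all small
positive parameters. -/
theorem eventually_combo_ne {u v : ℝ} (hv : v ≠ 0) :
    ∀ᶠ t : ℝ in 𝓝[>] 0, (1 - t) * u + t * v ≠ 0 := by
  by_cases hu : u = 0
  · filter_upwards [self_mem_nhdsWithin] with t ht
    simp [hu, hv, (ne_of_gt ht : t ≠ 0)]
  · have hc : Continuous fun t : ℝ => (1 - t) * u + t * v := by fun_prop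
    exact (hc.continuousAt.eventually_ne (by simpa using hu)).filter_mono nhdsWithin_le_nhds

theorem exists_generic {k n : ℕ} (hk : 2 ≤ k) (hn : k + 2 ≤ n) :
    ∃ y ∈ hypersimplex k n, ∀ I : Finset (Fin n), Function.Injective (dev I y) := by
  have hk' : (2 : ℝ) ≤ k := by exact_mod_cast hk
  have hn' : (k : ℝ) + 2 ≤ n := by exact_mod_cast hn
  -- The generic point has all entries but the last equal to an irrational `α`. The lower bound on
  -- `α` keeps the last entry below `1`, the upper one keeps it positive. Two relative heights then
  -- differ by a nonzero multiple of `α` plus an integer.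
  have hlt : ((k : ℝ) - 1) / (n - 1) < k / n := by
    rw [div_lt_div_iff₀ (by linarith) (by linarith)]
    nlinarith
  obtain ⟨α, hα, h1, h2⟩ := exists_irrational_btwn hlt
  rw [div_lt_iff₀ (by linarith)] at h1
  rw [lt_div_iff₀ (by linarith)] at h2
  have hα0 : 0 < α := by
    by_contra h
    nlinarith
  have hα1 : α < 1 := by
    by_contra h
    nlinarith
  set y : Fin n → ℝ := fun s => if s.val + 1 < n then α else k - (n - 1) * α with hy
  have hh : ∀ t, t + 1 ≤ n → height y t = t * α := by
    intro t ht
    induction t with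
    | zero => simp
    | succ t ih =>
      have := height_succ y ⟨t, by omega⟩
      simp only at this
      rw [this, ih (by omega)]
      have h3 : t + 1 < n := by omega
      simp only [hy, h3, if_true]
      push_cast
      ring
  refine ⟨y, ⟨fun i => ?_, ?_⟩, fun I i l h => ?_⟩
  · simp only [hy]
    split_ifs
    · exact ⟨hα0.le, hα1.le⟩
    · constructor <;> nlinarith
  · have h3 := height_succ y ⟨n - 1, by omega⟩
    simp only at h3
    rw [hh (n - 1) (by omega), show n - 1 + 1 = n by omega, height_self] at h3
    rw [h3]
    simp only [hy, show ¬ (n - 1 + 1 < n) by omega, if_false]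
    rw [Nat.cast_sub (by omega)]
    push_cast
    ring
  · simp only [dev, hh i i.isLt, hh l l.isLt] at h
    by_contra hne
    have h3 : ((i : ℤ) - (l : ℤ) : ℤ) ≠ 0 := by
      intro h4
      exact hne (Fin.ext (by omega))
    refine (hα.intCast_mul h3).ne_int (count I i - count I l) ?_
    push_cast
    linarith

/-- A small move from `x` toward a generic point makes both minima unique, hence lands in a nonempty
region. The finite union of the corresponding cells is closed, so it contains the limit `x`. -/
theorem cover_cells {k n : ℕ} (hk : 2 ≤ k) (hn : k + 2 ≤ n) (I J : Finset (Fin n))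
    {x : Fin n → ℝ} (hx : x ∈ hypersimplex k n) :
    ∃ i j, (region k I J i j).Nonempty ∧ x ∈ cell k I J i j := by
  obtain ⟨y, hy, hinj⟩ := exists_generic hk hn
  have hne : Nonempty (Fin n) := ⟨⟨0, by omega⟩⟩
  set S : Set (Fin n → ℝ) :=
    ⋃ p : {p : Fin n × Fin n // (region k I J p.1 p.2).Nonempty}, cell k I J p.1.1 p.1.2 with hS
  have hclosed : IsClosed S := isClosed_iUnion_of_finite fun _ => isClosed_cell
  have hgen : ∀ K : Finset (Fin n), ∀ᶠ t : ℝ in nhdsWithin 0 (Set.Ioi 0),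
      Function.Injective (dev K ((1 - t) • x + t • y)) := by
    intro K
    have h1 : ∀ᶠ t : ℝ in nhdsWithin 0 (Set.Ioi 0), ∀ p : {p : Fin n × Fin n // p.1 ≠ p.2},
        (1 - t) * (dev K x p.1.1 - dev K x p.1.2) + t * (dev K y p.1.1 - dev K y p.1.2) ≠ 0 :=
      Filter.eventually_all.2 fun p => eventually_combo_ne
        (sub_ne_zero.2 fun h => p.2 (hinj K h))
    filter_upwards [h1] with t ht a b hab
    by_contra hne
    refine ht ⟨(a, b), hne⟩ ?_
    rw [dev_combo _ _ _ _ (by ring), dev_combo _ _ _ _ (by ring)] at hab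
    simp only
    linarith
  have hmem : ∀ᶠ t : ℝ in nhdsWithin 0 (Set.Ioi 0), (1 - t) • x + t • y ∈ S := by
    have h01 : ∀ᶠ t : ℝ in nhdsWithin 0 (Set.Ioi 0), t < 1 :=
      (eventually_lt_nhds one_pos).filter_mono nhdsWithin_le_nhds
    filter_upwards [hgen I, hgen J, self_mem_nhdsWithin, h01] with t h1 h2 h3 h4
    have h3' : 0 < t := h3
    obtain ⟨i, hi⟩ := Finite.exists_min (dev I ((1 - t) • x + t • y))
    obtain ⟨j, hj⟩ := Finite.exists_min (dev J ((1 - t) • x + t • y))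
    have hr : (1 - t) • x + t • y ∈ region k I J i j :=
      ⟨convex_hypersimplex hx hy (by linarith) h3'.le (by ring),
        fun l hl => lt_of_le_of_ne (hi l) fun h => hl (h1 h).symm,
        fun l hl => lt_of_le_of_ne (hj l) fun h => hl (h2 h).symm⟩
    exact Set.mem_iUnion.2 ⟨⟨(i, j), ⟨_, hr⟩⟩, region_subset_cell hr⟩
  have hlim : Filter.Tendsto (fun t : ℝ => (1 - t) • x + t • y) (nhdsWithin 0 (Set.Ioi 0))
      (nhds x) := by
    have hc : Continuous fun t : ℝ => (1 - t) • x + t • y := by fun_prop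
    have := hc.tendsto 0
    simp only [sub_zero, one_smul, zero_smul, add_zero] at this
    exact this.mono_left nhdsWithin_le_nhds
  obtain ⟨⟨⟨i, j⟩, hp⟩, h⟩ := Set.mem_iUnion.1 (hclosed.mem_of_tendsto hlim hmem)
  exact ⟨i, j, hp, h⟩

/-- The chambers always form a polytopal subdivision as soon as they are polytopes. -/
theorem isPolytopalSubdivision_chambers {k n : ℕ} (hk : 2 ≤ k) (hn : k + 2 ≤ n)
    {I J : Finset (Fin n)} (hI : I.card = k) (hJ : J.card = k)
    (hpoly : ∀ C ∈ chambers k {I, J}, IsPolytope C) :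
    IsPolytopalSubdivision (hypersimplex k n) (chambers k {I, J}) := by
  have hn0 : 0 < n := by omega
  refine ⟨?_, hpoly, ?_, ?_, ?_⟩
  · refine (Set.finite_range fun p : Fin n × Fin n => cell k I J p.1 p.2).subset fun C hC => ?_
    obtain ⟨i, j, -, rfl⟩ := (mem_chambers hn0 hI hJ).1 hC
    exact ⟨(i, j), rfl⟩
  · intro C hC
    obtain ⟨i, j, h, rfl⟩ := (mem_chambers hn0 hI hJ).1 hC
    exact affineSpan_cell h
  · refine Set.Subset.antisymm (Set.sUnion_subset fun C hC => ?_) fun x hx => ?_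
    · obtain ⟨i, j, h, rfl⟩ := (mem_chambers hn0 hI hJ).1 hC
      exact fun x hx => hx.1
    · obtain ⟨i, j, h, hxc⟩ := cover_cells hk hn I J hx
      exact ⟨_, (mem_chambers hn0 hI hJ).2 ⟨i, j, h, rfl⟩, hxc⟩
  · intro C hC D hD
    obtain ⟨i, j, h, rfl⟩ := (mem_chambers hn0 hI hJ).1 hC
    obtain ⟨i', j', h', rfl⟩ := (mem_chambers hn0 hI hJ).1 hD
    refine ⟨isExposed_cell_inter, ?_⟩
    rw [Set.inter_comm]
    exact isExposed_cell_inter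

/-! ### Integrality of cells by random rounding -/

open MeasureTheory in
theorem integrable_floor_add (h : ℝ) :
    Integrable (fun θ : ℝ => ((⌊h + θ⌋ : ℤ) : ℝ)) (volume.restrict (Set.Ioc 0 1)) := by
  refine Integrable.of_bound (C := |h| + 2) ?_ ?_
  · have hm : Measurable fun θ : ℝ => ((⌊h + θ⌋ : ℤ) : ℝ) := by fun_prop
    exact hm.aestronglyMeasurable
  · refine (ae_restrict_iff' measurableSet_Ioc).2 (Filter.Eventually.of_forall fun θ hθ => ?_)
    have h1 := Int.floor_le (h + θ)
    have h2 := Int.lt_floor_add_one (h + θ)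
    have h3 := neg_abs_le h
    have h4 := le_abs_self h
    have h5 := hθ.1
    have h6 := hθ.2
    rw [Real.norm_eq_abs, abs_le]
    constructor <;> linarith

open MeasureTheory in
-- The fractional part has mean `1/2` over any period, which cancels the mean of `θ`.
theorem integral_floor_add (h : ℝ) : ∫ θ in Set.Ioc (0 : ℝ) 1, ((⌊h + θ⌋ : ℤ) : ℝ) = h := by
  have hper : Function.Periodic (fun u : ℝ => Int.fract u) 1 := fun u => Int.fract_add_one u
  have hint : ∀ c : ℝ, IntervalIntegrable (fun θ : ℝ => Int.fract (c + θ)) volume 0 1 := by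
    intro c
    rw [intervalIntegrable_iff_integrableOn_Ioc_of_le zero_le_one]
    refine Integrable.of_bound (C := 1) ?_ (Filter.Eventually.of_forall fun θ => ?_)
    · have hm : Measurable fun θ : ℝ => Int.fract (c + θ) := by fun_prop
      exact hm.aestronglyMeasurable
    · rw [Real.norm_eq_abs, abs_of_nonneg (Int.fract_nonneg _)]
      exact (Int.fract_lt_one _).le
  have h1 : ∫ θ in (0 : ℝ)..1, Int.fract (h + θ) = 1 / 2 := by
    rw [intervalIntegral.integral_comp_add_left (fun u => Int.fract u), add_zero,
      hper.intervalIntegral_add_eq h 0, zero_add]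
    have h2 : ∫ θ in (0 : ℝ)..1, Int.fract θ = ∫ θ in (0 : ℝ)..1, θ := by
      refine intervalIntegral.integral_congr_ae ?_
      have h3 : ∀ᵐ θ : ℝ, θ ≠ 1 := by simp [ae_iff]
      filter_upwards [h3] with θ h4 hθ
      rw [Set.uIoc_of_le zero_le_one] at hθ
      exact Int.fract_eq_self.2 ⟨hθ.1.le, lt_of_le_of_ne hθ.2 h4⟩
    rw [h2, integral_id]
    norm_num
  have h5 : ∀ θ : ℝ, ((⌊h + θ⌋ : ℤ) : ℝ) = h + θ - Int.fract (h + θ) := fun θ => by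
    rw [Int.fract]; ring
  rw [← intervalIntegral.integral_of_le zero_le_one]
  simp only [h5]
  rw [intervalIntegral.integral_sub (by apply Continuous.intervalIntegrable; fun_prop) (hint h), h1,
    intervalIntegral.integral_add (by simp) (by simp), integral_id]
  simp

/-- `e_B` is a vertex of `cell k I J i j`. -/
def IsCellBase (k : ℕ) {n : ℕ} (I J : Finset (Fin n)) (i j : Fin n) (B : Finset (Fin n)) : Prop :=
  B.card = k ∧ (∀ l : Fin n, count B i - count I i ≤ count B l - count I l) ∧
    ∀ l : Fin n, count B j - count J j ≤ count B l - count J l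

section Rounding

variable {k n : ℕ} {I J : Finset (Fin n)} {i j : Fin n}

theorem dev_vertex (B : Finset (Fin n)) (l : Fin n) :
    dev I (vertex B) l = ((count B l - count I l : ℤ) : ℝ) := by
  rw [dev, height_vertex]; push_cast; rfl

theorem vertex_mem_hypersimplex {B : Finset (Fin n)} :
    vertex B ∈ hypersimplex k n ↔ B.card = k := by
  rw [mem_hypersimplex, sum_vertex, Nat.cast_inj, and_iff_right_iff_imp]
  intro _ i
  simp only [vertex]
  split_ifs <;> simp

theorem vertex_mem_cell {B : Finset (Fin n)} :
    vertex B ∈ cell k I J i j ↔ IsCellBase k I J i j B := by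
  simp only [cell, Set.mem_ofPred_eq, vertex_mem_hypersimplex, dev_vertex, Int.cast_le, IsCellBase]

/-- The finset obtained by rounding down the heights of `x`, shifted by `θ`. -/
noncomputable def rounding {n : ℕ} (x : Fin n → ℝ) (θ : ℝ) : Finset (Fin n) :=
  ofHeight n fun t => ⌊height x t + θ⌋

theorem floor_height_succ {x : Fin n → ℝ} (hx : x ∈ hypersimplex k n) (θ : ℝ) (s : Fin n) :
    ⌊height x (s + 1) + θ⌋ = ⌊height x s + θ⌋ ∨ ⌊height x (s + 1) + θ⌋ = ⌊height x s + θ⌋ + 1 := by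
  have h := hx.1 s
  rw [height_succ]
  have h1 : ⌊height x s + θ⌋ ≤ ⌊height x s + x s + θ⌋ := Int.floor_le_floor (by linarith)
  have h2 : ⌊height x s + x s + θ⌋ ≤ ⌊height x s + θ⌋ + 1 := by
    rw [← Int.floor_add_one]
    exact Int.floor_le_floor (by linarith)
  omega

theorem count_rounding {x : Fin n → ℝ} (hx : x ∈ hypersimplex k n) (θ : ℝ) {t : ℕ} (ht : t ≤ n) :
    count (rounding x θ) t = ⌊height x t + θ⌋ - ⌊θ⌋ := by
  have h := count_ofHeight (F := fun t => ⌊height x t + θ⌋)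
    (fun s hs => floor_height_succ hx θ ⟨s, hs⟩) ht
  simpa [rounding] using h

/-- The floor is monotone and commutes with integer translations, so inequalities between heights
with integer constants survive it. -/
theorem isCellBase_rounding {x : Fin n → ℝ} (hx : x ∈ cell k I J i j) (θ : ℝ) :
    IsCellBase k I J i j (rounding x θ) := by
  have key : ∀ K : Finset (Fin n), ∀ a l : Fin n, dev K x a ≤ dev K x l →
      count (rounding x θ) a - count K a ≤ count (rounding x θ) l - count K l := by
    intro K a l h
    rw [count_rounding hx.1 θ a.isLt.le, count_rounding hx.1 θ l.isLt.le]
    simp only [dev] at h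
    have h1 : ⌊height x a + θ⌋ + (count K l - count K a) ≤ ⌊height x l + θ⌋ := by
      rw [← Int.floor_add_intCast]
      apply Int.floor_le_floor
      push_cast
      linarith
    omega
  refine ⟨?_, fun l => key I i l (hx.2.1 l), fun l => key J j l (hx.2.2 l)⟩
  have h := count_rounding hx.1 θ le_rfl
  rw [count_self, height_self, hx.1.2, add_comm, Int.floor_add_natCast] at h
  omega

theorem vertex_rounding {x : Fin n → ℝ} (hx : x ∈ hypersimplex k n) (θ : ℝ) (s : Fin n) :
    vertex (rounding x θ) s = (⌊height x (s + 1) + θ⌋ : ℝ) - ⌊height x s + θ⌋ := by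
  simp only [vertex, rounding, ofHeight, Finset.mem_filter, Finset.mem_univ, true_and]
  rcases floor_height_succ hx θ s with h | h <;> simp [h]

/-- A point of the cell is the mean of the vertices of its roundings over `θ` uniform in `(0, 1]`.
There are finitely many vertices, so their hull is closed and contains that mean. -/
theorem cell_eq_convexHull :
    cell k I J i j = convexHull ℝ {v | ∃ B, IsCellBase k I J i j B ∧ v = vertex B} := by
  have hconv : Convex ℝ (cell k I J i j) := by
    intro x hx y hy a b ha hb hab
    refine ⟨convex_hypersimplex hx.1 hy.1 ha hb hab, fun l => ?_, fun l => ?_⟩ <;>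
      rw [dev_combo _ _ _ _ hab, dev_combo _ _ _ _ hab]
    · exact add_le_add (mul_le_mul_of_nonneg_left (hx.2.1 l) ha)
        (mul_le_mul_of_nonneg_left (hy.2.1 l) hb)
    · exact add_le_add (mul_le_mul_of_nonneg_left (hx.2.2 l) ha)
        (mul_le_mul_of_nonneg_left (hy.2.2 l) hb)
  refine Set.Subset.antisymm (fun x hx => ?_) (convexHull_min ?_ hconv)
  · have hfin : {v : Fin n → ℝ | ∃ B, IsCellBase k I J i j B ∧ v = vertex B}.Finite :=
      (Set.finite_range (vertex (n := n))).subset (by rintro _ ⟨B, -, rfl⟩; exact ⟨B, rfl⟩)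
    have hprob : MeasureTheory.IsProbabilityMeasure
        (MeasureTheory.volume.restrict (Set.Ioc (0 : ℝ) 1)) := ⟨by simp⟩
    have hint : ∀ s, MeasureTheory.Integrable (fun θ : ℝ => vertex (rounding x θ) s)
        (MeasureTheory.volume.restrict (Set.Ioc (0 : ℝ) 1)) := by
      intro s
      simp only [vertex_rounding hx.1]
      exact (integrable_floor_add _).sub (integrable_floor_add _)
    have h1 := (convex_convexHull ℝ _).integral_mem (hfin.isClosed_convexHull ℝ)
      (Filter.Eventually.of_forall fun θ : ℝ => subset_convexHull ℝ _
        ⟨rounding x θ, isCellBase_rounding hx θ, rfl⟩)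
      (MeasureTheory.Integrable.of_eval hint)
    convert h1 using 1
    ext s
    rw [MeasureTheory.eval_integral hint]
    simp only [vertex_rounding hx.1]
    rw [MeasureTheory.integral_sub (integrable_floor_add _) (integrable_floor_add _),
      integral_floor_add, integral_floor_add, height_succ]
    ring
  · rintro _ ⟨B, hB, rfl⟩
    exact vertex_mem_cell.2 hB

/-- A vertex of the hypersimplex in the convex hull of some vertices is one of them. -/
theorem vertex_mem_convexHull {P : Finset (Fin n) → Prop} {B : Finset (Fin n)}
    (h : vertex B ∈ convexHull ℝ {v | ∃ B', P B' ∧ v = vertex B'}) : P B := by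
  by_contra hB
  -- On 0/1 vectors `φ` exceeds its value at `vertex B` by the size of the symmetric difference with
  -- `B`.
  let φ : (Fin n → ℝ) → ℝ := fun v => ∑ s, (1 - 2 * vertex B s) * v s
  have hlin : IsLinearMap ℝ φ := by
    constructor
    · intro x y; simp [φ, mul_add, Finset.sum_add_distrib]
    · intro c x; simp only [φ, Pi.smul_apply, smul_eq_mul, Finset.mul_sum]
      exact Finset.sum_congr rfl fun s _ => by ring
  have hsub := convexHull_min (s := {v | ∃ B', P B' ∧ v = vertex B'})
    (t := {v | φ (vertex B) + 1 ≤ φ v}) ?_ (convex_halfSpace_ge hlin _) h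
  · have : φ (vertex B) + 1 ≤ φ (vertex B) := hsub
    linarith
  · rintro _ ⟨B', hB', rfl⟩
    have hne : ∃ s, ¬ (s ∈ B' ↔ s ∈ B) := by
      by_contra hcon
      push Not at hcon
      exact hB ((Finset.ext hcon : B' = B) ▸ hB')
    obtain ⟨s, hs⟩ := hne
    change φ (vertex B) + 1 ≤ φ (vertex B')
    have h1 : ∀ r, 0 ≤ (1 - 2 * vertex B r) * vertex B' r - (1 - 2 * vertex B r) * vertex B r := by
      intro r
      by_cases h2 : r ∈ B <;> by_cases h3 : r ∈ B' <;> simp [vertex, h2, h3]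
    have h4 : (1 : ℝ) ≤ (1 - 2 * vertex B s) * vertex B' s - (1 - 2 * vertex B s) * vertex B s := by
      by_cases h2 : s ∈ B <;> by_cases h3 : s ∈ B' <;> simp [h2, h3] at hs <;>
        simp [vertex, h2, h3]
      norm_num
    have h5 := Finset.single_le_sum (fun r _ => h1 r) (Finset.mem_univ s)
    rw [Finset.sum_sub_distrib] at h5
    simp only [φ]
    linarith

end Rounding

/-! ### Crossings and alternation of the gap around a level -/

/-- The four indices `a, b, c, d` appear in this cyclic order. -/
def CyclicLt {n : ℕ} (a b c d : Fin n) : Prop :=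
  (a < b ∧ b < c ∧ c < d) ∨ (b < c ∧ c < d ∧ d < a) ∨ (c < d ∧ d < a ∧ a < b) ∨
    (d < a ∧ a < b ∧ b < c)

theorem CyclicLt.rotate {n : ℕ} {a b c d : Fin n} (h : CyclicLt a b c d) : CyclicLt b c d a := by
  unfold CyclicLt at *; tauto

/-- There are alternating elements of `I \ J` and `J \ I`. -/
def Crossing {n : ℕ} (I J : Finset (Fin n)) : Prop :=
  ∃ i₁ ∈ I \ J, ∃ i₂ ∈ I \ J, ∃ j₁ ∈ J \ I, ∃ j₂ ∈ J \ I, CyclicLt i₁ j₁ i₂ j₂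

theorem weaklySeparated_iff {n : ℕ} {I J : Finset (Fin n)} :
    WeaklySeparated I J ↔ ¬ Crossing I J := Iff.rfl

theorem Crossing.symm {n : ℕ} {I J : Finset (Fin n)} (h : Crossing I J) : Crossing J I := by
  obtain ⟨i₁, h1, i₂, h2, j₁, h3, j₂, h4, h⟩ := h
  exact ⟨j₁, h3, j₂, h4, i₂, h2, i₁, h1, h.rotate⟩

section Crossing

variable {n : ℕ} {I J : Finset (Fin n)}

/-- The difference of the heights of two vertices. -/
def gap (I J : Finset (Fin n)) (t : ℕ) : ℤ := count I t - count J t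

theorem gap_neg (I J : Finset (Fin n)) (t : ℕ) : gap J I t = - gap I J t := by
  simp only [gap]; ring

theorem gap_zero (I J : Finset (Fin n)) : gap I J 0 = 0 := by simp [gap]

theorem gap_self (h : I.card = J.card) : gap I J n = 0 := by simp [gap, count_self, h]

theorem gap_succ_of_mem {s : Fin n} (h : s ∈ I \ J) : gap I J (s + 1) = gap I J s + 1 := by
  rw [Finset.mem_sdiff] at h
  simp only [gap, count_succ, h.1, h.2, if_true, if_false]
  ring

theorem mem_sdiff_of_gap_lt {s : Fin n} (h : gap I J s < gap I J (s + 1)) : s ∈ I \ J := by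
  simp only [gap, count_succ] at h
  rw [Finset.mem_sdiff]
  split_ifs at h with h1 h2 h2 <;> first | exact ⟨h1, h2⟩ | omega

theorem exists_up_step {a b : ℕ} (hab : a ≤ b) (hb : b ≤ n) (h : gap I J a < gap I J b) :
    ∃ s ∈ I \ J, a ≤ s.val ∧ s.val < b := by
  induction b, hab using Nat.le_induction with
  | base => omega
  | succ b hab ih =>
    rcases lt_or_ge (gap I J a) (gap I J b) with h1 | h1
    · obtain ⟨s, h2, h3, h4⟩ := ih (by omega) h1
      exact ⟨s, h2, h3, by omega⟩
    · exact ⟨⟨b, hb⟩, mem_sdiff_of_gap_lt (by simp only; omega), hab, Nat.lt_succ_self b⟩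

theorem exists_down_step {a b : ℕ} (hab : a ≤ b) (hb : b ≤ n) (h : gap I J b < gap I J a) :
    ∃ s ∈ J \ I, a ≤ s.val ∧ s.val < b :=
  exists_up_step hab hb (by rw [gap_neg I J, gap_neg I J]; omega)

theorem crossing_of_alternating_linear (hc : I.card = J.card) {a b c d : Fin n} {t : ℤ}
    (hab : a < b) (hbc : b < c) (hcd : c < d) (ha : gap I J a ≤ t) (hb : t < gap I J b)
    (hc' : gap I J c ≤ t) (hd : t < gap I J d) : Crossing I J := by
  rw [Fin.lt_def] at hab hbc hcd
  obtain ⟨s₁, h1, h1', h1''⟩ := exists_up_step (I := I) (J := J) hab.le b.isLt.le (by omega)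
  obtain ⟨s₂, h2, h2', h2''⟩ := exists_down_step (I := I) (J := J) hbc.le c.isLt.le (by omega)
  obtain ⟨s₃, h3, h3', h3''⟩ := exists_up_step (I := I) (J := J) hcd.le d.isLt.le (by omega)
  -- The fourth step lies on the way back from `d` to `a`, where the gap passes through `0` at the
  -- ends: it descends after `d` if positive there, and otherwise before `a`, where it is negative.
  rcases lt_or_ge 0 (gap I J d) with h | h
  · obtain ⟨s₄, h4, h4', h4''⟩ := exists_down_step (I := I) (J := J) d.isLt.le le_rfl
      (by rw [gap_self hc]; exact h)
    refine ⟨s₁, h1, s₃, h3, s₂, h2, s₄, h4, ?_⟩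
    simp only [CyclicLt, Fin.lt_def]
    omega
  · obtain ⟨s₄, h4, h4', h4''⟩ := exists_down_step (I := I) (J := J) (Nat.zero_le a) a.isLt.le
      (by rw [gap_zero]; omega)
    refine ⟨s₁, h1, s₃, h3, s₂, h2, s₄, h4, ?_⟩
    simp only [CyclicLt, Fin.lt_def]
    omega

theorem crossing_of_alternating (hc : I.card = J.card) {a b c d : Fin n} {t : ℤ}
    (h : CyclicLt a b c d) (ha : gap I J a ≤ t) (hb : t < gap I J b)
    (hc' : gap I J c ≤ t) (hd : t < gap I J d) : Crossing I J := by
  rcases h with ⟨h1, h2, h3⟩ | ⟨h1, h2, h3⟩ | ⟨h1, h2, h3⟩ | ⟨h1, h2, h3⟩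
  · exact crossing_of_alternating_linear hc h1 h2 h3 ha hb hc' hd
  -- An odd rotation exchanges high and low. Negating the gap restores them, and for integers `t <
  -- g` becomes `-g ≤ -t - 1`.
  · refine (crossing_of_alternating_linear (t := -t - 1) hc.symm h1 h2 h3 ?_ ?_ ?_ ?_).symm <;>
      rw [gap_neg I J] <;> omega
  · exact crossing_of_alternating_linear hc h1 h2 h3 hc' hd ha hb
  · refine (crossing_of_alternating_linear (t := -t - 1) hc.symm h1 h2 h3 ?_ ?_ ?_ ?_).symm <;>
      rw [gap_neg I J] <;> omega

/-- The four steps `w` cut the cycle into arcs; `b`, `d` maximize and `a`, `c` minimize the gap on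
alternate arcs. Each step changes the gap by one between adjacent arcs, so both maxima strictly
exceed both minima's neighbouring values, and the larger minimum serves as level. -/
theorem exists_alternating_linear (hc : I.card = J.card) {w₁ w₂ w₃ w₄ : Fin n}
    (h12 : w₁ < w₂) (h23 : w₂ < w₃) (h34 : w₃ < w₄) (h1 : w₁ ∈ I \ J) (h2 : w₂ ∈ J \ I)
    (h3 : w₃ ∈ I \ J) (h4 : w₄ ∈ J \ I) :
    ∃ (a b c d : Fin n) (t : ℤ), CyclicLt a b c d ∧ gap I J a ≤ t ∧ t < gap I J b ∧
      gap I J c ≤ t ∧ t < gap I J d := by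
  have e1 := gap_succ_of_mem h1
  have e2 := gap_succ_of_mem h2
  have e3 := gap_succ_of_mem h3
  have e4 := gap_succ_of_mem h4
  rw [gap_neg I J, gap_neg I J] at e2 e4
  have n0 := gap_zero I J
  have n1 := gap_self hc
  rw [Fin.lt_def] at h12 h23 h34
  have hw4 := w₄.isLt
  let G : Fin n → ℤ := fun v => gap I J v
  obtain ⟨b, hb, hb'⟩ := (Finset.Ioc w₁ w₂).exists_max_image G
    ⟨w₂, by rw [Finset.mem_Ioc]; exact ⟨h12, le_rfl⟩⟩
  obtain ⟨c, hcm, hc'⟩ := (Finset.Ioc w₂ w₃).exists_min_image G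
    ⟨w₃, by rw [Finset.mem_Ioc]; exact ⟨h23, le_rfl⟩⟩
  obtain ⟨d, hd, hd'⟩ := (Finset.Ioc w₃ w₄).exists_max_image G
    ⟨w₄, by rw [Finset.mem_Ioc]; exact ⟨h34, le_rfl⟩⟩
  obtain ⟨a, ha, ha'⟩ := (Finset.univ.filter fun v => v ≤ w₁ ∨ w₄ < v).exists_min_image G
    ⟨w₁, by simp⟩
  simp only [Finset.mem_Ioc, Finset.mem_filter, Finset.mem_univ, true_and, Fin.lt_def, Fin.le_def,
    G] at *
  have a1 := ha' w₁ (by omega)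
  have b1 := hb' ⟨w₁ + 1, by omega⟩ (by simp only; omega)
  have b2 := hb' w₂ (by omega)
  have c1 := hc' ⟨w₂ + 1, by omega⟩ (by simp only; omega)
  have c2 := hc' w₃ (by omega)
  have d1 := hd' ⟨w₃ + 1, by omega⟩ (by simp only; omega)
  have d2 := hd' w₄ (by omega)
  -- The arc of `a` wraps around: if `w₄` is the last position, its successor is `0`, where the gap
  -- equals that at `n`.
  have a2 : gap I J a ≤ gap I J (w₄ + 1) := by
    by_cases h : w₄.val + 1 < n
    · exact ha' ⟨w₄ + 1, h⟩ (by simp only; omega)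
    · rw [show w₄.val + 1 = n by omega, n1, ← n0]
      exact ha' ⟨0, by omega⟩ (by simp only; omega)
  simp only at b1 c1 d1
  refine ⟨a, b, c, d, max (gap I J a) (gap I J c), ?_, ?_⟩
  · simp only [CyclicLt, Fin.lt_def]
    omega
  · omega

theorem Crossing.exists_alternating (hc : I.card = J.card) (h : Crossing I J) :
    ∃ (a b c d : Fin n) (t : ℤ), CyclicLt a b c d ∧ gap I J a ≤ t ∧ t < gap I J b ∧
      gap I J c ≤ t ∧ t < gap I J d := by
  have flip : (∃ (a b c d : Fin n) (t : ℤ), CyclicLt a b c d ∧ gap J I a ≤ t ∧ t < gap J I b ∧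
      gap J I c ≤ t ∧ t < gap J I d) →
      ∃ (a b c d : Fin n) (t : ℤ), CyclicLt a b c d ∧ gap I J a ≤ t ∧ t < gap I J b ∧
      gap I J c ≤ t ∧ t < gap I J d := by
    rintro ⟨a, b, c, d, t, h, h1, h2, h3, h4⟩
    rw [gap_neg I J] at h1 h2 h3 h4
    exact ⟨b, c, d, a, -t - 1, h.rotate, by omega, by omega, by omega, by omega⟩
  obtain ⟨i₁, h1, i₂, h2, j₁, h3, j₂, h4, h⟩ := h
  rcases h with ⟨h5, h6, h7⟩ | ⟨h5, h6, h7⟩ | ⟨h5, h6, h7⟩ | ⟨h5, h6, h7⟩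
  · exact exists_alternating_linear hc h5 h6 h7 h1 h3 h2 h4
  · exact flip (exists_alternating_linear hc.symm h5 h6 h7 h3 h2 h4 h1)
  · exact exists_alternating_linear hc h5 h6 h7 h2 h4 h1 h3
  · exact flip (exists_alternating_linear hc.symm h5 h6 h7 h4 h1 h3 h2)

end Crossing

/-! ### Cyclic offsets and level sets forced to be arcs -/

section Transitions

variable {n : ℕ}

/-- The number of forward steps from `j` to `x` in the cyclic order. -/
def offset (j x : Fin n) : ℕ := if j.val ≤ x.val then x.val - j.val else x.val + n - j.val

/-- The successor of `e` in the cyclic order. -/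
def next (e : Fin n) : Fin n := ⟨if e.val + 1 < n then e.val + 1 else 0, by
  have := e.isLt
  split_ifs <;> omega⟩

/-- The amount by which exchanging `e` for `f` changes the height at `v`. -/
def shift (e f v : Fin n) : ℤ := (if f.val < v.val then 1 else 0) - if e.val < v.val then 1 else 0

theorem offset_self (j : Fin n) : offset j j = 0 := by simp [offset]

theorem offset_lt (j x : Fin n) : offset j x < n := by
  have := j.isLt
  have := x.isLt
  simp only [offset]
  split_ifs <;> omega

theorem offset_injective (j : Fin n) : Function.Injective (offset j) := by
  intro x y h
  have := j.isLt
  have := x.isLt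
  have := y.isLt
  simp only [offset] at h
  apply Fin.ext
  split_ifs at h <;> omega

theorem offset_eq (j i x : Fin n) : offset i x =
    if offset j i ≤ offset j x then offset j x - offset j i
    else offset j x + n - offset j i := by
  have := j.isLt
  have := x.isLt
  have := i.isLt
  simp only [offset]
  split_ifs <;> omega

theorem lt_indicator_offset (j f v : Fin n) :
    (if offset j f < offset j v then (1 : ℤ) else 0) =
      (if f.val < v.val then 1 else 0) - (if f.val < j.val then 1 else 0) +
        if v.val < j.val then 1 else 0 := by
  have := j.isLt
  have := f.isLt
  have := v.isLt
  simp only [offset]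
  split_ifs <;> omega

/-- Moving the origin to `j` changes the shift by a constant in `v`, so comparisons of shifts do not
depend on where the cycle is cut. -/
theorem shift_eq_offset (j e f v : Fin n) : shift e f v = shift e f j +
    ((if offset j f < offset j v then 1 else 0) - if offset j e < offset j v then 1 else 0) := by
  rw [lt_indicator_offset, lt_indicator_offset]
  simp only [shift]
  ring

theorem cyclicLt_iff_offset {a b c d : Fin n} (j : Fin n) : CyclicLt a b c d ↔
    (offset j a < offset j b ∧ offset j b < offset j c ∧ offset j c < offset j d) ∨
    (offset j b < offset j c ∧ offset j c < offset j d ∧ offset j d < offset j a) ∨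
    (offset j c < offset j d ∧ offset j d < offset j a ∧ offset j a < offset j b) ∨
    (offset j d < offset j a ∧ offset j a < offset j b ∧ offset j b < offset j c) := by
  have := j.isLt
  have := a.isLt
  have := b.isLt
  have := c.isLt
  have := d.isLt
  simp only [CyclicLt, Fin.lt_def, offset]
  split_ifs <;> omega

/-- If every entry into `A` can be exchanged for an exit from `A` without leaving the cell with
apices `i ∈ A` and `j ∉ A`, then `A` is final in the cyclic interval from `j` to `i`. -/
theorem final_of_exchange {A : Fin n → Prop} {i j : Fin n} (hi : A i) (hj : ¬ A j)
    (hex : ∀ e, ¬ A e → A (next e) → ∃ f, A f ∧ (∀ l, A l → shift e f i ≤ shift e f l) ∧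
      ∀ l, ¬ A l → shift e f j ≤ shift e f l)
    {l₁ l₂ : Fin n} (h1 : A l₁) (h2 : ¬ A l₂) (h12 : offset j l₁ ≤ offset j l₂) :
    offset j i < offset j l₂ := by
  by_contra hcon
  push Not at hcon
  -- Seen from `j`, `v` is the first point of `A` and its predecessor `e` is an entry into `A`. The
  -- exchange lowers the height at `v` relative to `j`, so comparing `i` with `v` puts `f` at or
  -- beyond `i`, while comparing `j` with `l₂` puts `f` before `l₂`.
  obtain ⟨v, hv, hmin⟩ := Set.exists_min_image {v | A v} (offset j) (Set.toFinite _) ⟨i, hi⟩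
  have hvA : A v := hv
  have hvj : v.val ≠ j.val := fun h => hj (Fin.ext h ▸ hvA)
  have hvn := v.isLt
  have hjn := j.isLt
  let e : Fin n := ⟨if v.val = 0 then n - 1 else v.val - 1, by split_ifs <;> omega⟩
  have he : next e = v := by
    apply Fin.ext
    simp only [next, e]
    split_ifs <;> omega
  have hev : offset j e + 1 = offset j v := by
    simp only [offset, e]
    split_ifs <;> omega
  have heA : ¬ A e := fun h => absurd (hmin e h) (by omega)
  obtain ⟨f, hf, hf1, hf2⟩ := hex e heA (he ▸ hvA)
  have g1 := hmin f hf
  have g2 := hf1 v hvA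
  have g3 := hf2 l₂ h2
  have g4 := hmin l₁ h1
  have hl2v : offset j l₂ ≠ offset j v := fun h => h2 (offset_injective j h ▸ hvA)
  rw [shift_eq_offset j e f i, shift_eq_offset j e f v] at g2
  rw [shift_eq_offset j e f l₂] at g3
  split_ifs at g2 g3 <;> omega

/-- From `j` to `i` the set `A` is final; by the same argument from `i` to `j` its complement is
final. Hence `A` is a single cyclic interval. -/
theorem not_alternating_of_exchange {A : Fin n → Prop} {i j : Fin n} (hi : A i) (hj : ¬ A j)
    (hup : ∀ e, ¬ A e → A (next e) → ∃ f, A f ∧ (∀ l, A l → shift e f i ≤ shift e f l) ∧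
      ∀ l, ¬ A l → shift e f j ≤ shift e f l)
    (hdown : ∀ e, A e → ¬ A (next e) → ∃ f, ¬ A f ∧ (∀ l, ¬ A l → shift e f j ≤ shift e f l) ∧
      ∀ l, A l → shift e f i ≤ shift e f l)
    {a b c d : Fin n} (h : CyclicLt a b c d) (ha : ¬ A a) (hb : A b) (hc : ¬ A c) (hd : A d) :
    False := by
  have up : ∀ {l₁ l₂ : Fin n}, A l₁ → ¬ A l₂ → offset j l₂ ≤ offset j i →
      offset j l₂ < offset j l₁ := fun h1 h2 h3 => by
    by_contra h4
    exact absurd (final_of_exchange hi hj hup h1 h2 (not_lt.1 h4)) (not_lt.2 h3)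
  have down : ∀ {l₁ l₂ : Fin n}, ¬ A l₁ → A l₂ → offset j i ≤ offset j l₂ →
      offset j l₁ < offset j i ∨ offset j l₂ < offset j l₁ := fun {l₁ l₂} h1 h2 h3 => by
    by_contra h4
    have h5 := final_of_exchange (A := fun v => ¬ A v) (l₁ := l₁) (l₂ := l₂) hj (not_not.2 hi)
      (fun e h1 h2 => by
        obtain ⟨f, h3, h4, h5⟩ := hdown e (not_not.1 h1) h2
        exact ⟨f, h3, h4, fun l hl => h5 l (not_not.1 hl)⟩) h1 (not_not.2 h2)
    rw [offset_eq j i l₁, offset_eq j i l₂, offset_eq j i j, offset_self] at h5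
    have h6 := offset_lt j l₂
    have h7 : 0 < offset j i := Nat.pos_of_ne_zero fun h =>
      hj (offset_injective j (h.trans (offset_self j).symm) ▸ hi)
    split_ifs at h5 <;> omega
  have u1 := up hb ha
  have u2 := up hb hc
  have u3 := up hd ha
  have u4 := up hd hc
  have d1 := down ha hb
  have d2 := down ha hd
  have d3 := down hc hb
  have d4 := down hc hd
  have h' := (cyclicLt_iff_offset j).1 h
  omega

end Transitions

/-! ### Cyclic intervals and their intersections -/

section Arcs

variable {n : ℕ}

/-- The cyclic interval from `i` (included) to `l` (excluded). -/
def arc (i l : Fin n) : Finset (Fin n) := Finset.univ.filter fun s => offset i s < offset i l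

theorem mem_arc {i l s : Fin n} : s ∈ arc i l ↔ offset i s < offset i l := by simp [arc]

theorem count_eq_sum (B : Finset (Fin n)) (t : ℕ) :
    count B t = ∑ s ∈ B, if s.val < t then (1 : ℤ) else 0 := by
  rw [count, height, Finset.sum_filter, ← Finset.sum_filter_add_sum_filter_not Finset.univ (· ∈ B)]
  have h1 : ∑ s ∈ Finset.univ.filter (fun s => ¬ s ∈ B),
      (if s.val < t then if s ∈ B then (1 : ℤ) else 0 else 0) = 0 :=
    Finset.sum_eq_zero fun s hs => by simp [(Finset.mem_filter.1 hs).2]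
  rw [h1, add_zero, Finset.filter_mem_eq_inter, Finset.univ_inter]
  exact Finset.sum_congr rfl fun s hs => by simp [hs]

theorem card_inter_arc (B : Finset (Fin n)) (i l : Fin n) :
    ((B ∩ arc i l).card : ℤ) = count B l - count B i + if l < i then (B.card : ℤ) else 0 := by
  have h1 : ((B ∩ arc i l).card : ℤ) = ∑ s ∈ B, if offset i s < offset i l then (1 : ℤ) else 0 := by
    rw [Finset.sum_boole, show B ∩ arc i l = B.filter fun s => offset i s < offset i l by
      ext s; simp [mem_arc]]
  rw [h1, count_eq_sum, count_eq_sum]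
  simp only [lt_indicator_offset, Finset.sum_add_distrib, Finset.sum_sub_distrib, Finset.sum_const,
    Fin.lt_def]
  split_ifs <;> simp

/-- The last two cases are proper overlaps: the intersection runs from the start of one arc to the
end of the other, and the cyclic order of the endpoints is what later produces a crossing. -/
theorem arc_inter_cases {i l j m e : Fin n} (h1 : e ∈ arc i l) (h2 : e ∈ arc j m) :
    arc i l ⊆ arc j m ∨ arc j m ⊆ arc i l ∨ arc i l ∪ arc j m = Finset.univ ∨
      (arc i l ∩ arc j m = arc j l ∧ CyclicLt j l m i) ∨
      (arc i l ∩ arc j m = arc i m ∧ CyclicLt i m l j) := by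
  simp only [Finset.subset_iff, Finset.ext_iff, Finset.mem_union, Finset.mem_inter,
    Finset.mem_univ, iff_true, mem_arc, cyclicLt_iff_offset i, offset_self] at *
  simp only [offset_eq i j] at *
  have hlt := offset_lt i
  have hl := hlt l
  have hj := hlt j
  have hm := hlt m
  have he := hlt e
  generalize offset i l = l' at *
  generalize offset i j = j' at *
  generalize offset i m = m' at *
  rcases le_or_gt j' m' with c1 | c1
  · rcases le_or_gt m' l' with c2 | c2
    · right; left
      intro s
      have := hlt s
      split_ifs <;> omega
    · rcases Nat.eq_zero_or_pos j' with c3 | c3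
      · left
        intro s
        have := hlt s
        split_ifs <;> omega
      · right; right; right; left
        have c4 : j' < l' := by split_ifs at h2 <;> omega
        refine ⟨fun s => ?_, by omega⟩
        have := hlt s
        split_ifs <;> omega
  · rcases le_or_gt l' m' with c2 | c2
    · left
      intro s
      have := hlt s
      split_ifs <;> omega
    · rcases le_or_gt j' l' with c3 | c3
      · right; right; left
        intro s
        have := hlt s
        split_ifs <;> omega
      · right; right; right; right
        have c4 : 0 < m' := by split_ifs at h2 <;> omega
        refine ⟨fun s => ?_, by omega⟩
        have := hlt s
        split_ifs <;> omega

/-- Among the arcs from `i` to a point of `Z` that contain `e`, if there are any, one is the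
smallest. -/
theorem exists_min_arc (i e : Fin n) (Z : Fin n → Prop) :
    ∃ S : Finset (Fin n), e ∈ S ∧ (S = Finset.univ ∨ ∃ l, Z l ∧ S = arc i l) ∧
      ∀ l, Z l → e ∈ arc i l → S ⊆ arc i l := by
  by_cases h : ∃ l, Z l ∧ e ∈ arc i l
  · obtain ⟨l, hl, hmin⟩ := Set.exists_min_image {l | Z l ∧ e ∈ arc i l} (offset i)
      (Set.toFinite _) h
    refine ⟨arc i l, hl.2, Or.inr ⟨l, hl.1, rfl⟩, fun m h1 h2 s hs => ?_⟩
    have h3 := hmin m ⟨h1, h2⟩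
    rw [mem_arc] at hs ⊢
    omega
  · exact ⟨Finset.univ, Finset.mem_univ e, Or.inl rfl, fun l h1 h2 => absurd ⟨l, h1, h2⟩ h⟩

theorem exists_mem_of_card_inter_le {B B' X : Finset (Fin n)} {e : Fin n} (he : e ∈ B)
    (he' : e ∉ B') (heX : e ∈ X) (h : (B ∩ X).card ≤ (B' ∩ X).card) :
    ∃ f ∈ X, f ∈ B' ∧ f ∉ B := by
  by_contra hcon
  push Not at hcon
  have h1 : B' ∩ X ⊆ (B ∩ X).erase e := fun f hf => by
    rw [Finset.mem_inter] at hf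
    rw [Finset.mem_erase, Finset.mem_inter]
    exact ⟨fun h => he' (h ▸ hf.1), hcon f hf.2 hf.1, hf.2⟩
  have h2 := Finset.card_le_card h1
  have h3 := Finset.card_erase_lt_of_mem (Finset.mem_inter.2 ⟨he, heX⟩)
  omega

theorem card_inter_inter_of_union {S T : Finset (Fin n)} (h : S ∪ T = Finset.univ)
    (B : Finset (Fin n)) : (B ∩ (S ∩ T)).card + B.card = (B ∩ S).card + (B ∩ T).card := by
  have h1 := Finset.card_union_add_card_inter (B ∩ S) (B ∩ T)
  rw [← Finset.inter_union_distrib_left, h, Finset.inter_univ,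
    ← Finset.inter_inter_distrib_left] at h1
  omega

end Arcs

/-! ### Weak separation implies basis exchange -/

section Exchange

variable {k n : ℕ} {I J : Finset (Fin n)} {i j : Fin n} {B B' : Finset (Fin n)}

theorem IsCellBase.symm (h : IsCellBase k I J i j B) : IsCellBase k J I j i B := ⟨h.1, h.2.2, h.2.1⟩

/-- `B` attains the bound of the plate at `e_I` with apex `i` at the position `l`. -/
def Tight (I : Finset (Fin n)) (i : Fin n) (B : Finset (Fin n)) (l : Fin n) : Prop :=
  count B l - count I l = count B i - count I i

theorem card_inter_arc_le (hB : IsCellBase k I J i j B) (hB' : IsCellBase k I J i j B')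
    {l : Fin n} (hl : Tight I i B l) : (B ∩ arc i l).card ≤ (B' ∩ arc i l).card := by
  zify
  rw [card_inter_arc, card_inter_arc, hB.1, hB'.1]
  have h1 := hB'.2.1 l
  unfold Tight at hl
  linarith

/-- If `B` had more elements in the overlap, the gap would be at most `t` at `j` and `m` but above
`t` at `l` and `i`, where `t` is the difference of the two minimal relative heights of `B`. That is
a crossing. -/
theorem card_inter_arc_le_of_cyclicLt (hI : I.card = k) (hJ : J.card = k) (hIJ : ¬ Crossing I J)
    (hB : IsCellBase k I J i j B) (hB' : IsCellBase k I J i j B') {l m : Fin n}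
    (hl : Tight I i B l) (hm : Tight J j B m) (hc : CyclicLt j l m i) :
    (B ∩ arc j l).card ≤ (B' ∩ arc j l).card := by
  zify
  rw [card_inter_arc, card_inter_arc, hB.1, hB'.1]
  by_contra hlt
  refine hIJ (crossing_of_alternating (hI.trans hJ.symm) hc
    (t := count B j - count J j - (count B i - count I i)) ?_ ?_ ?_ ?_)
  all_goals
    have h1 := hB.2.1 m
    have h2 := hB.2.1 j
    have h3 := hB.2.2 i
    have h4 := hB'.2.1 l
    have h5 := hB'.2.2 l
    have h6 := hB'.2.2 i
    simp only [Tight, gap] at *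
    omega

theorem exists_exchange (hI : I.card = k) (hJ : J.card = k) (hIJ : ¬ Crossing I J)
    (hB : IsCellBase k I J i j B) (hB' : IsCellBase k I J i j B') {e : Fin n} (he : e ∈ B)
    (he' : e ∉ B') : ∃ f ∈ B', f ∉ B ∧ IsCellBase k I J i j (insert f (B.erase e)) := by
  obtain ⟨S, heS, hS, hSmin⟩ := exists_min_arc i e (Tight I i B)
  obtain ⟨T, heT, hT, hTmin⟩ := exists_min_arc j e (Tight J j B)
  have cS : (B ∩ S).card ≤ (B' ∩ S).card := by
    rcases hS with rfl | ⟨l, hl, rfl⟩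
    · simp [hB.1, hB'.1]
    · exact card_inter_arc_le hB hB' hl
  have cT : (B ∩ T).card ≤ (B' ∩ T).card := by
    rcases hT with rfl | ⟨l, hl, rfl⟩
    · simp [hB.1, hB'.1]
    · exact card_inter_arc_le hB.symm hB'.symm hl
  have cST : (B ∩ (S ∩ T)).card ≤ (B' ∩ (S ∩ T)).card := by
    rcases hS with rfl | ⟨l, hl, rfl⟩
    · simpa using cT
    rcases hT with rfl | ⟨m, hm, rfl⟩
    · simpa using cS
    rcases arc_inter_cases heS heT with h | h | h | ⟨h, hc⟩ | ⟨h, hc⟩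
    · rwa [Finset.inter_eq_left.2 h]
    · rwa [Finset.inter_eq_right.2 h]
    · have h1 := card_inter_inter_of_union h B
      have h2 := card_inter_inter_of_union h B'
      have h3 := hB.1
      have h4 := hB'.1
      omega
    · rw [h]
      exact card_inter_arc_le_of_cyclicLt hI hJ hIJ hB hB' hl hm hc
    · rw [h]
      exact card_inter_arc_le_of_cyclicLt hJ hI (fun h => hIJ h.symm) hB.symm hB'.symm hm hl hc
  obtain ⟨f, hf, hfB', hfB⟩ :=
    exists_mem_of_card_inter_le he he' (Finset.mem_inter.2 ⟨heS, heT⟩) cST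
  rw [Finset.mem_inter] at hf
  -- The exchange lowers the count by one on arcs containing `e` but not `f`. A strict integer
  -- inequality absorbs this loss, so only tight arcs matter.
  have key : ∀ (K : Finset (Fin n)) (a l : Fin n), count B a - count K a ≤ count B l - count K l →
      (Tight K a B l → e ∈ arc a l → f ∈ arc a l) →
      count (insert f (B.erase e)) a - count K a ≤ count (insert f (B.erase e)) l - count K l := by
    intro K a l h1 h2
    rw [count_exchange he hfB, count_exchange he hfB]
    have e1 := lt_indicator_offset a e l
    have e2 := lt_indicator_offset a f l
    simp only [mem_arc, Tight] at h2
    split_ifs at e1 e2 ⊢ <;> omega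
  refine ⟨f, hfB', hfB, ?_, fun l => key I i l (hB.2.1 l) fun h1 h2 => hSmin l h1 h2 hf.1,
    fun l => key J j l (hB.2.2 l) fun h1 h2 => hTmin l h1 h2 hf.2⟩
  rw [card_exchange he hfB, hB.1]

theorem isMatroidPolytope_cell (hI : I.card = k) (hJ : J.card = k) (hIJ : ¬ Crossing I J)
    (hne : (cell k I J i j).Nonempty) : IsMatroidPolytope (cell k I J i j) := by
  have hcell := cell_eq_convexHull (k := k) (I := I) (J := J) (i := i) (j := j)
  have hbase : ∃ X : Set (Fin n), ∃ B : Finset (Fin n), IsCellBase k I J i j B ∧ X = B := by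
    rw [hcell, convexHull_nonempty_iff] at hne
    obtain ⟨_, B, hB, -⟩ := hne
    exact ⟨_, B, hB, rfl⟩
  refine ⟨Matroid.ofIsBaseOfFinite (E := Set.univ) Set.finite_univ
    (fun X => ∃ B : Finset (Fin n), IsCellBase k I J i j B ∧ X = B) hbase ?_
    (fun _ _ => Set.subset_univ _), rfl, ?_⟩
  · rintro _ _ ⟨B, hB, rfl⟩ ⟨B', hB', rfl⟩ e hee
    obtain ⟨he, he'⟩ := (Set.mem_sdiff e).1 hee
    obtain ⟨f, hf, hf', h⟩ := exists_exchange hI hJ hIJ hB hB' (Finset.mem_coe.1 he)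
      (fun h => he' (Finset.mem_coe.2 h))
    exact ⟨f, ⟨Finset.mem_coe.2 hf, fun h => hf' (Finset.mem_coe.1 h)⟩, _, h, by simp⟩
  · rw [hcell]
    congr 1
    ext v
    constructor
    · rintro ⟨B, hB, rfl⟩
      exact ⟨B, ⟨B, hB, rfl⟩, rfl⟩
    · rintro ⟨B, ⟨B', hB', h⟩, rfl⟩
      exact ⟨B, Finset.coe_injective h ▸ hB', rfl⟩

theorem IsMatroidPolytope.isPolytope {C : Set (Fin n → ℝ)} (h : IsMatroidPolytope C) :
    IsPolytope C := by
  obtain ⟨M, -, hC⟩ := h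
  exact ⟨_, (Set.finite_range (vertex (n := n))).subset (by rintro _ ⟨B, -, rfl⟩; exact ⟨B, rfl⟩),
    hC⟩

end Exchange

/-! ### A crossing destroys basis exchange -/

section Converse

variable {k n : ℕ} {I J : Finset (Fin n)} {i j : Fin n}

/-- The finset whose height is the maximum of the height of `I` and the height of `J` raised
by `t`. -/
def tropicalSum (I J : Finset (Fin n)) (t : ℤ) : Finset (Fin n) :=
  ofHeight n fun v => max (count I v) (count J v + t)

theorem count_tropicalSum (I J : Finset (Fin n)) (t : ℤ) {v : ℕ} (hv : v ≤ n) :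
    count (tropicalSum I J t) v = max (count I v) (count J v + t) - max 0 t := by
  rw [tropicalSum, count_ofHeight _ hv]
  · simp
  · intro s hs
    have h1 := count_succ I ⟨s, hs⟩
    have h2 := count_succ J ⟨s, hs⟩
    simp only at h1 h2
    rw [h1, h2]
    split_ifs <;> omega

theorem card_tropicalSum (hI : I.card = k) (hJ : J.card = k) (t : ℤ) :
    (tropicalSum I J t).card = k := by
  have h := count_tropicalSum I J t le_rfl
  rw [count_self, count_self, count_self, hI, hJ] at h
  omega

/-- A maximum of two functions minus one of them is least wherever that one attains the maximum. -/
theorem isCellBase_tropicalSum (hI : I.card = k) (hJ : J.card = k) {t : ℤ}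
    (hi : t ≤ gap I J i) (hj : gap I J j ≤ t) : IsCellBase k I J i j (tropicalSum I J t) := by
  refine ⟨card_tropicalSum hI hJ t, fun l => ?_, fun l => ?_⟩ <;>
    rw [count_tropicalSum I J t l.isLt.le, count_tropicalSum I J t (Fin.isLt _).le] <;>
    simp only [gap] at hi hj <;> omega

theorem mem_tropicalSum {t : ℤ} {s : Fin n} : s ∈ tropicalSum I J t ↔
    max (count I (s + 1)) (count J (s + 1) + t) = max (count I s) (count J s + t) + 1 := by
  simp [tropicalSum, ofHeight]

theorem gap_next (hIJ : I.card = J.card) (e : Fin n) : gap I J (next e) = gap I J (e + 1) := by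
  simp only [next]
  split_ifs with h
  · rfl
  · have := e.isLt
    rw [show e.val + 1 = n by omega, gap_zero, gap_self hIJ]

/-- The steps lost from level `t` to `t + 1` are the entries into the set where the gap exceeds `t`;
the steps gained are its exits. -/
theorem mem_sdiff_tropicalSum {t : ℤ} {s : Fin n} :
    s ∈ tropicalSum I J t \ tropicalSum I J (t + 1) ↔ gap I J s ≤ t ∧ t < gap I J (s + 1) := by
  rw [Finset.mem_sdiff, mem_tropicalSum, mem_tropicalSum]
  simp only [gap, count_succ]
  split_ifs <;> omega

theorem mem_sdiff_tropicalSum' {t : ℤ} {s : Fin n} :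
    s ∈ tropicalSum I J (t + 1) \ tropicalSum I J t ↔ t < gap I J s ∧ gap I J (s + 1) ≤ t := by
  rw [Finset.mem_sdiff, mem_tropicalSum, mem_tropicalSum]
  simp only [gap, count_succ]
  split_ifs <;> omega

/-- The apices of a cell that contains the midpoint of two consecutive tropical sums. -/
theorem apex_of_midpoint_mem {t : ℤ} {a b : Fin n} (ha : gap I J a ≤ t) (hb : t < gap I J b)
    (h : (1 / 2 : ℝ) • vertex (tropicalSum I J t) + (1 / 2 : ℝ) • vertex (tropicalSum I J (t + 1)) ∈
      cell k I J i j) : t < gap I J i ∧ gap I J j ≤ t := by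
  -- Relative to `I` the midpoint is minimal exactly where the gap exceeds `t`, relative to `J`
  -- exactly where it does not; `b` and `a` witness that both loci are nonempty.
  have h1 := h.2.1 b
  have h2 := h.2.2 a
  rw [dev_combo _ _ _ _ (by norm_num), dev_combo _ _ _ _ (by norm_num), dev_vertex, dev_vertex,
    dev_vertex, dev_vertex] at h1 h2
  have h1' : (((count (tropicalSum I J t) i - count I i) +
      (count (tropicalSum I J (t + 1)) i - count I i) : ℤ) : ℝ) ≤
      ((count (tropicalSum I J t) b - count I b) +
      (count (tropicalSum I J (t + 1)) b - count I b) : ℤ) := by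
    rw [Int.cast_add, Int.cast_add]; linarith
  have h2' : (((count (tropicalSum I J t) j - count J j) +
      (count (tropicalSum I J (t + 1)) j - count J j) : ℤ) : ℝ) ≤
      ((count (tropicalSum I J t) a - count J a) +
      (count (tropicalSum I J (t + 1)) a - count J a) : ℤ) := by
    rw [Int.cast_add, Int.cast_add]; linarith
  rw [Int.cast_le] at h1' h2'
  simp only [count_tropicalSum, Fin.is_le', gap] at *
  omega

theorem not_isMatroidPolytope_cell (hI : I.card = k) (hJ : J.card = k) {a b c d : Fin n} {t : ℤ}
    (h : CyclicLt a b c d) (ha : gap I J a ≤ t) (hb : t < gap I J b) (hc : gap I J c ≤ t)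
    (hd : t < gap I J d) (hi : t < gap I J i) (hj : gap I J j ≤ t) :
    ¬ IsMatroidPolytope (cell k I J i j) := by
  rintro ⟨M, -, hM⟩
  have hbase : ∀ B : Finset (Fin n), M.IsBase B ↔ IsCellBase k I J i j B := by
    intro B
    rw [← vertex_mem_cell, hM]
    exact ⟨fun h => subset_convexHull ℝ _ ⟨B, h, rfl⟩,
      fun h => vertex_mem_convexHull (P := fun B : Finset (Fin n) => M.IsBase (B : Set (Fin n))) h⟩
  have hex : ∀ {B B' : Finset (Fin n)}, IsCellBase k I J i j B → IsCellBase k I J i j B' →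
      ∀ e ∈ B \ B', ∃ f ∈ B' \ B, IsCellBase k I J i j (insert f (B.erase e)) := by
    intro B B' hB hB' e he
    obtain ⟨f, hf, hf'⟩ := ((hbase B).2 hB).exchange ((hbase B').2 hB') (e := e) (by
      rw [← Finset.coe_sdiff]; exact he)
    rw [← Finset.coe_sdiff] at hf
    refine ⟨f, hf, (hbase _).1 ?_⟩
    rwa [Finset.coe_insert, Finset.coe_erase]
  have hB := isCellBase_tropicalSum hI hJ hi.le hj
  have hB' := isCellBase_tropicalSum (i := i) (j := j) (t := t + 1) hI hJ hi (by omega)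
  -- Both tropical sums are tight for `I` wherever the gap exceeds `t` and for `J` everywhere else,
  -- so an admissible exchange may not lower these positions relative to the apices.
  have hshift : ∀ {u : ℤ} {e f : Fin n}, u = t ∨ u = t + 1 → e ∈ tropicalSum I J u →
      f ∉ tropicalSum I J u →
      IsCellBase k I J i j (insert f ((tropicalSum I J u).erase e)) →
      (∀ l : Fin n, t < gap I J l → shift e f i ≤ shift e f l) ∧
      ∀ l : Fin n, ¬ t < gap I J l → shift e f j ≤ shift e f l := by
    intro u e f hu he hf hbase
    constructor <;> intro l hl
    · have h1 := hbase.2.1 l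
      rw [count_exchange he hf, count_exchange he hf, count_tropicalSum _ _ _ l.isLt.le,
        count_tropicalSum _ _ _ i.isLt.le] at h1
      simp only [gap, shift] at *
      omega
    · have h1 := hbase.2.2 l
      rw [count_exchange he hf, count_exchange he hf, count_tropicalSum _ _ _ l.isLt.le,
        count_tropicalSum _ _ _ j.isLt.le] at h1
      simp only [gap, shift] at *
      omega
  refine not_alternating_of_exchange (A := fun v : Fin n => t < gap I J v) hi (not_lt.2 hj) ?_ ?_ h
    (not_lt.2 ha) hb (not_lt.2 hc) hd
  · intro e h1 h2
    rw [gap_next (hI.trans hJ.symm)] at h2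
    have he := mem_sdiff_tropicalSum.2 ⟨not_lt.1 h1, h2⟩
    obtain ⟨f, hf, hf'⟩ := hex hB hB' e he
    exact ⟨f, (mem_sdiff_tropicalSum'.1 hf).1, hshift (Or.inl rfl) (Finset.mem_sdiff.1 he).1
      (Finset.mem_sdiff.1 hf).2 hf'⟩
  · intro e h1 h2
    rw [gap_next (hI.trans hJ.symm)] at h2
    have he := mem_sdiff_tropicalSum'.2 ⟨h1, not_lt.1 h2⟩
    obtain ⟨f, hf, hf'⟩ := hex hB' hB e he
    exact ⟨f, not_lt.2 (mem_sdiff_tropicalSum.1 hf).1, (hshift (Or.inr rfl)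
      (Finset.mem_sdiff.1 he).1 (Finset.mem_sdiff.1 hf).2 hf').symm⟩

end Converse

end BladeArrangement

theorem mainTheorem3 (k n : ℕ) (hk : 2 ≤ k) (hn : k + 2 ≤ n) (I₁ I₂ : Finset (Fin n))
    (hI₁ : I₁.card = k) (hI₂ : I₂.card = k) :
    BladeArrangement.InducesMatroidSubdivision k {I₁, I₂} ↔
      BladeArrangement.WeaklySeparated I₁ I₂ := by
  open BladeArrangement in
  have hn0 : 0 < n := by omega
  rw [weaklySeparated_iff]
  constructor
  · rintro ⟨hsub, hmat⟩ hcross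
    obtain ⟨a, b, c, d, t, h, ha, hb, hc, hd⟩ := hcross.exists_alternating (hI₁.trans hI₂.symm)
    -- Whichever chamber covers this midpoint, its apices are on the two sides of the level `t`, and
    -- it fails to be a matroid polytope.
    have hx : (1 / 2 : ℝ) • vertex (tropicalSum I₁ I₂ t) +
        (1 / 2 : ℝ) • vertex (tropicalSum I₁ I₂ (t + 1)) ∈ hypersimplex k n :=
      convex_hypersimplex (vertex_mem_hypersimplex.2 (card_tropicalSum hI₁ hI₂ t))
        (vertex_mem_hypersimplex.2 (card_tropicalSum hI₁ hI₂ (t + 1)))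
        (by norm_num) (by norm_num) (by norm_num)
    rw [← hsub.cover] at hx
    obtain ⟨C, hC, hxC⟩ := hx
    have hCm := hmat C hC
    obtain ⟨i, j, -, rfl⟩ := (mem_chambers hn0 hI₁ hI₂).1 hC
    obtain ⟨hi, hj⟩ := apex_of_midpoint_mem ha hb hxC
    exact not_isMatroidPolytope_cell hI₁ hI₂ h ha hb hc hd hi hj hCm
  · intro hws
    have hmat : ∀ C ∈ chambers k {I₁, I₂}, IsMatroidPolytope C := by
      intro C hC
      obtain ⟨i, j, hne, rfl⟩ := (mem_chambers hn0 hI₁ hI₂).1 hC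
      exact isMatroidPolytope_cell hI₁ hI₂ hws (hne.mono region_subset_cell)
    exact ⟨isPolytopalSubdivision_chambers hk hn hI₁ hI₂ fun C hC => (hmat C hC).isPolytope, hmat⟩
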